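/- Let $n\ge 2$. For $\sigma\in\mathfrak{S}_n$, let $\mathrm{Des}(\sigma)=\{1\le i\le n-1:\sigma(i)>\sigma(i+1)\}$, and let $\mathrm{run}(\sigma)$ be the number of alternating runs of $\sigma$, i.e. of maximal monotone sequences of consecutive letters of $\sigma(1),\dots,\sigma(n)$. Let $W_{k}^+$ (resp. $W_{k}^-$) be the sum in $\mathbb{Q}[\mathfrak{S}_n]$ of all $\sigma$ with $\mathrm{run}(\sigma)=k$ whose first run is ascending (resp. descending), and let $\mathcal{W}_n^\pm$ be the linear span of $W_k^+,W_k^-$ for $1\le k\le n-1$. Let $\mathbf{Sym}$ be the free associative $\mathbb{Q}$-algebra, with product $\star$, on generators $S_1,S_2,\dots$ with $\deg S_i=i$, put $S_0=1$, and let $\widehat{\mathbf{Sym}}$ be its completion with respect to the degree. For a composition $I=(i_1,\dots,i_r)$ of $n$ put $S^I=S_{i_1}\star\cdots\star S_{i_r}$ and $\mathrm{Des}(I)=\{i_1,i_1+i_2,\dots,i_1+\cdots+i_{r-1}\}$, and $R_I=\sum_{\mathrm{Des}(J)\subseteq\mathrm{Des}(I)}(-1)^{\ell(I)-\ell(J)}S^J$.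 The degree $n$ component of $\mathbf{Sym}$ is identified with a subspace of $\mathbb{Q}[\mathfrak{S}_n]$ by $S^I\mapsto\sum_{\mathrm{Des}(\sigma)\subseteq\mathrm{Des}(I)}\sigma$. In $\widehat{\mathbf{Sym}}$ put $V_1^+=\sum_{i\ge0}S_i$, $V_1^-=\sum_{i\ge0}R_{(1^i)}$, $V_2^+=V_1^+\star V_1^-$, $V_2^-=V_1^-\star V_1^+$, and, with $\log_\star$, $\exp_\star$ given by the usual power series and $G^{\star a}=\exp_\star(a\log_\star G)$, for $k\ge0$, $$I_k^\pm=\frac1{k!}\Bigl(\tfrac12\log_\star V_2^\pm\Bigr)^{\star k},\qquad J_k^+=V_1^+\star(V_2^-)^{\star(-1/2)}\star I_k^-,\qquad J_k^-=V_1^-\star(V_2^+)^{\star(-1/2)}\star I_k^+ .$$ Let $I_{k,n}^\pm,J_{k,n}^\pm\in\mathbb{Q}[\mathfrak{S}_n]$ denote their degree $n$ parts. Then $\mathcal{W}_n^\pm$ is a unital subalgebra of $\mathbb{Q}[\mathfrak{S}_n]$, and a complete set of primitive orthogonal idempotents for $\mathcal{W}_n^\pm$ (nonzero pairwise orthogonal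 idempotents with sum $1$, none of which is the sum of two nonzero orthogonal idempotents of $\mathcal{W}_n^\pm$) is given by the elements $$\tfrac12(I_{k,n}^++I_{k,n}^-),\quad 1\le k\le n,\ k\equiv n \bmod 2,$$ $$\tfrac12(J_{l,n}^++J_{l,n}^--I_{l,n}^+-I_{l,n}^-),\quad 0\le l\le n-4,\ l\equiv n\bmod 2,$$ $$\tfrac12(J_{m,n}^+-J_{m,n}^-),\quad 0\le m\le n-2,\ m\equiv n\bmod 2,$$ where elements with different labels are distinct. -/

import Mathlib

namespace RunAlgebra

/-! ### Descents, alternating runs, and the run algebra -/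

/-- The rational group algebra `ℚ[𝔖ₙ]`; the product of permutations is composition,
`(σ * τ) i = σ (τ i)`. -/
abbrev GroupAlg (n : ℕ) : Type := MonoidAlgebra ℚ (Equiv.Perm (Fin n))

/-- The descent set of the word `σ₁ … σₙ`, with the usual positions `1, …, n - 1`:
`i` is a descent when `σᵢ > σᵢ₊₁`. The letters `σᵢ, σᵢ₊₁` sit at the indices `i - 1, i` of `Fin n`. -/
def descents {n : ℕ} (σ : Equiv.Perm (Fin n)) : Finset ℕ :=
  {i ∈ Finset.Ico 1 n | ∃ (h₁ : i - 1 < n) (h₂ : i < n), σ ⟨i, h₂⟩ < σ ⟨i - 1, h₁⟩}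

/-- The number of alternating runs (maximal monotone sequences of consecutive letters) of
`σ₁ … σₙ`, for `n ≥ 2`: one more than the number of positions `2 ≤ i ≤ n - 1` at which `σ` changes
direction, that is, such that exactly one of `i - 1`, `i` is a descent. -/
def run {n : ℕ} (σ : Equiv.Perm (Fin n)) : ℕ :=
  1 + (Finset.card {i ∈ Finset.Ico 2 n | ¬ (i - 1 ∈ descents σ ↔ i ∈ descents σ)})

/-- `Wₖ⁺`: the sum of the permutations with `k` alternating runs, the first one ascending. -/
noncomputable def Wplus (n k : ℕ) : GroupAlg n :=
  ∑ σ : Equiv.Perm (Fin n) with run σ = k ∧ 1 ∉ descents σ, MonoidAlgebra.single σ (1 : ℚ)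

/-- `Wₖ⁻`: the sum of the permutations with `k` alternating runs, the first one descending. -/
noncomputable def Wminus (n k : ℕ) : GroupAlg n :=
  ∑ σ : Equiv.Perm (Fin n) with run σ = k ∧ 1 ∈ descents σ, MonoidAlgebra.single σ (1 : ℚ)

/-- `𝒲ₙ^±`: the linear span of the `Wₖ⁺`, `Wₖ⁻` for `1 ≤ k ≤ n - 1`. -/
noncomputable def runSpace (n : ℕ) : Submodule ℚ (GroupAlg n) :=
  Submodule.span ℚ {x | ∃ k, 1 ≤ k ∧ k ≤ n - 1 ∧ (x = Wplus n k ∨ x = Wminus n k)}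

/-! ### Noncommutative symmetric functions -/

/-- Noncommutative symmetric functions over `ℚ`, with the external product `⋆`: the free algebra on
`S₁, S₂, …`. Its basis of words `(i₁, …, iᵣ)` in the positive integers (compositions) is the complete
basis `S^(i₁, …, iᵣ) = S_{i₁} ⋆ ⋯ ⋆ S_{iᵣ}`. The multiplication of this type is `⋆`. -/
abbrev NSym : Type := MonoidAlgebra ℚ (FreeMonoid ℕ+)

/-- Formal series `∑ₙ Fₙ Xⁿ` over `NSym`, with the product `⋆`. The completion of `NSym` is the subring
of the series whose `n`-th coefficient is homogeneous of degree `n` for all `n`; the formal variable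
only records the degree. All the series defined below belong to that subring. -/
abbrev NSymHat : Type := PowerSeries NSym

/-- The complete noncommutative symmetric function `Sₙ`, with `S₀ = 1`. -/
noncomputable def S (n : ℕ) : NSym :=
  if h : 0 < n then MonoidAlgebra.single (FreeMonoid.of (⟨n, h⟩ : ℕ+)) (1 : ℚ) else 1

/-- `S^I` for a composition `I` of `n`. -/
noncomputable def complete {n : ℕ} (I : Composition n) : NSym :=
  (I.blocks.map S).prod

/-- The ribbon `R_I = ∑_{J ≼ I} (-1)^(ℓ(I) - ℓ(J)) S^J`, where `J ≼ I` means that the descent set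
(equivalently, the set of boundaries) of `J` is contained in that of `I`. -/
noncomputable def ribbon {n : ℕ} (I : Composition n) : NSym :=
  ∑ J : Composition n with J.boundaries ⊆ I.boundaries,
    ((-1 : ℚ) ^ (I.length - J.length)) • complete J

/-- The degree of a word, i.e. the sum of its letters. -/
def degree (w : FreeMonoid ℕ+) : ℕ := (w.toList.map (fun i : ℕ+ => (i : ℕ))).sum

/-- The descent set `{i₁, i₁ + i₂, …, i₁ + ⋯ + iᵣ₋₁}` of the composition `w = (i₁, …, iᵣ)`. -/
def wordDescents (w : FreeMonoid ℕ+) : Finset ℕ :=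
  (Finset.Ico 1 w.toList.length).image
    (fun j => ((w.toList.take j).map (fun i : ℕ+ => (i : ℕ))).sum)

/-- The element `∑_{Des σ ⊆ Des w} σ` of the group algebra. -/
noncomputable def completeSum (n : ℕ) (w : FreeMonoid ℕ+) : GroupAlg n :=
  ∑ σ : Equiv.Perm (Fin n) with descents σ ⊆ wordDescents w, MonoidAlgebra.single σ (1 : ℚ)

/-- The linear map that takes the homogeneous component of degree `n` and identifies it with the
descent algebra in `ℚ[𝔖ₙ]` by `S^I ↦ ∑_{Des σ ⊆ Des I} σ`. -/
noncomputable def toGroupAlg (n : ℕ) : NSym →ₗ[ℚ] GroupAlg n :=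
  (Finsupp.linearCombination ℚ
      (fun w : FreeMonoid ℕ+ => if degree w = n then completeSum n w else 0)).comp
    (MonoidAlgebra.coeffLinearEquiv ℚ).toLinearMap

/-- The degree `n` part of a series, as an element of `ℚ[𝔖ₙ]`. -/
noncomputable def degreePart (n : ℕ) (F : NSymHat) : GroupAlg n :=
  toGroupAlg n (PowerSeries.coeff n F)

/-! ### Formal exponential, logarithm and powers for `⋆` -/

/-- `∑_{j ≥ 0} cⱼ F^{⋆j}`, for a series `F` with no term of degree `0` (so that only the terms with
`j ≤ n` contribute to degree `n`). -/
noncomputable def substStar (c : ℕ → ℚ) (F : NSymHat) : NSymHat :=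
  PowerSeries.mk fun n => ∑ j ∈ Finset.range (n + 1), c j • PowerSeries.coeff n (F ^ j)

/-- `exp_⋆ F = ∑_{j ≥ 0} F^{⋆j} / j!`, for `F` with no term of degree `0`. -/
noncomputable def expStar (F : NSymHat) : NSymHat :=
  substStar (fun j => 1 / (j.factorial : ℚ)) F

/-- `log_⋆ (1 + F) = ∑_{j ≥ 1} (-1)^(j-1) F^{⋆j} / j`, for `F` with no term of degree `0`; the argument
is `G = 1 + F`. (The term `j = 0` vanishes, as division by zero gives zero.) -/
noncomputable def logStar (G : NSymHat) : NSymHat :=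
  substStar (fun j => (-1 : ℚ) ^ (j + 1) / (j : ℚ)) (G - 1)

/-- `G^{⋆a} = exp_⋆ (a log_⋆ G)` for a rational exponent `a` and `G` with degree `0` term `1`. -/
noncomputable def powStar (G : NSymHat) (a : ℚ) : NSymHat :=
  expStar (a • logStar G)

/-! ### The idempotents -/

/-- `V₁⁺ = ∑ₙ R_(n) = ∑ₙ Sₙ`. -/
noncomputable def V1plus : NSymHat := PowerSeries.mk S

/-- `V₁⁻ = ∑ₙ R_(1ⁿ)`. -/
noncomputable def V1minus : NSymHat := PowerSeries.mk fun n => ribbon (Composition.ones n)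

/-- `V₂⁺ = V₁⁺ ⋆ V₁⁻`. -/
noncomputable def V2plus : NSymHat := V1plus * V1minus

/-- `V₂⁻ = V₁⁻ ⋆ V₁⁺`. -/
noncomputable def V2minus : NSymHat := V1minus * V1plus

/-- `Iₖ⁺ = (1 / k!) (½ log_⋆ V₂⁺)^{⋆k}`. -/
noncomputable def Iplus (k : ℕ) : NSymHat :=
  (1 / (k.factorial : ℚ)) • ((1 / 2 : ℚ) • logStar V2plus) ^ k

/-- `Iₖ⁻ = (1 / k!) (½ log_⋆ V₂⁻)^{⋆k}`. -/
noncomputable def Iminus (k : ℕ) : NSymHat :=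
  (1 / (k.factorial : ℚ)) • ((1 / 2 : ℚ) • logStar V2minus) ^ k

/-- `Jₖ⁺ = V₁⁺ ⋆ (V₂⁻)^{⋆(-1/2)} ⋆ Iₖ⁻`. -/
noncomputable def Jplus (k : ℕ) : NSymHat :=
  V1plus * powStar V2minus (-1 / 2) * Iminus k

/-- `Jₖ⁻ = V₁⁻ ⋆ (V₂⁺)^{⋆(-1/2)} ⋆ Iₖ⁺`. -/
noncomputable def Jminus (k : ℕ) : NSymHat :=
  V1minus * powStar V2plus (-1 / 2) * Iplus k

/-- The integers `k` with `a ≤ k ≤ n - d` and `k ≡ n mod 2` (none if `n < a + d`). -/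
def parityRange (n a d : ℕ) : Finset ℕ :=
  {k ∈ Finset.range (n + 1) | a ≤ k ∧ k + d ≤ n ∧ k ≡ n [MOD 2]}

/-- The indices of the three families: `1 ≤ k ≤ n`, `0 ≤ l ≤ n - 4` and `0 ≤ m ≤ n - 2`, all
congruent to `n` modulo `2`. -/
abbrev Index (n : ℕ) : Type :=
  {k // k ∈ parityRange n 1 0} ⊕ {l // l ∈ parityRange n 0 4} ⊕ {m // m ∈ parityRange n 0 2}

/-- The idempotents `½(Iₖ⁺ + Iₖ⁻)`, `½(Jₗ⁺ + Jₗ⁻ - Iₗ⁺ - Iₗ⁻)` and `½(Jₘ⁺ - Jₘ⁻)` in degree `n`. -/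
noncomputable def runIdempotent (n : ℕ) : Index n → GroupAlg n
  | .inl k => degreePart n ((1 / 2 : ℚ) • (Iplus k + Iminus k))
  | .inr (.inl l) => degreePart n ((1 / 2 : ℚ) • (Jplus l + Jminus l - Iplus l - Iminus l))
  | .inr (.inr m) => degreePart n ((1 / 2 : ℚ) • (Jplus m - Jminus m))

/-! ### Primitive idempotents in a ring -/

/-- A primitive idempotent: a nonzero idempotent that is not a sum of two nonzero orthogonal
idempotents of the ring. -/
def IsPrimitiveIdempotent {R : Type*} [Ring R] (e : R) : Prop :=
  IsIdempotentElem e ∧ e ≠ 0 ∧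
    ∀ f g : R, IsIdempotentElem f → IsIdempotentElem g → f * g = 0 → g * f = 0 → e = f + g →
      f = 0 ∨ g = 0

/-- A complete set of primitive orthogonal idempotents: pairwise orthogonal primitive idempotents
with sum `1` (being nonzero and orthogonal, the members of the family are distinct). -/
def IsCompletePrimitiveOrthogonal {R ι : Type*} [Ring R] [Fintype ι] (e : ι → R) : Prop :=
  CompleteOrthogonalIdempotents e ∧ ∀ i, IsPrimitiveIdempotent (e i)

end RunAlgebra

namespace RunAlgebra

/-! ### Sorting permutations of functions to a signed chain -/

/-! Deal the letters into `x` blocks in all possible ways, list each block in increasing or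
decreasing order alternately, and add up the resulting permutations: this is `blockSum n s x`, where
`s` fixes the direction of the first block. Two facts drive the proof. Dealing twice is dealing once
into more blocks, so `blockSum n s x * blockSum n t y = blockSum n (s + t * x) (x * y)`
(`blockSum_mul`). And `blockSum n s x` is the degree `n` part of an alternating product of `x`
factors `V₁⁺`, `V₁⁻` (`degreePart_altSeries`); the latter is seen by letting noncommutative
symmetric functions act on the intervals of `ℕ`, where both sides count the ways to cut a word with
a given descent set into alternating monotone blocks.

For `x` of fixed parity, the alternating product is `(A ⋆ B)^(x/2)` or `A ⋆ (B ⋆ A)^((x-1)/2)`, so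
in each degree it is a polynomial in `x` with coefficients `Iₖ^±` or `Jₖ^±`. Comparing coefficients
in `blockSum_mul` gives the multiplication table `groupCoeff_mul`: different `k` annihilate each
other, and for one `k` the symbols `(x, s)` modulo 2 multiply like the affine maps `z ↦ s + x z` of
the two-element field. Thus `Jₖ⁺` acts as the identity map, `Jₖ⁻` as the transposition and `Iₖ^±` as
the two constant maps. In the algebra of this monoid `½(I⁺ + I⁻)`, `½(J⁺ + J⁻ - I⁺ - I⁻)`, `½(J⁺ -
J⁻)` are orthogonal idempotents with sum `J⁺`, each with `e x e` a multiple of `e`, and `I⁺ - I⁻`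
spans the radical.

It remains to see which of these elements vanish. The coefficient of a permutation in `blockSum n s
x` depends only on its number of runs and its first direction, by the relation
`stepOp_stepOp_stepOp` between transfer operators, and the dependence is triangular; so the block
sums span the run space, of dimension `2(n - 1)`. On the other side, `V₁⁻(X) = V₁⁺(-X)⁻¹` kills all
`k` of the wrong parity, `I₀^±` vanishes, the four coefficients agree for `k = n`, and `J⁺ + J⁻ = I⁺
+ I⁻` for `k = n - 2`. Exactly `2(n - 1)` elements are left; they span, hence form a basis, and in
particular the listed idempotents are nonzero. -/

/-- The block `b` of an alternating sequence of blocks is ascending when `s + b` is even. The sorting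
key of the letter `v` when it is put into the block `f v`. -/
def sortKey {n : ℕ} (s : ℕ) (f : Fin n → ℕ) (v : Fin n) : ℕ ×ₗ ℤ :=
  toLex (f v, if Even (s + f v) then (v : ℤ) else -(v : ℤ))

theorem sortKey_injective {n : ℕ} (s : ℕ) (f : Fin n → ℕ) : Function.Injective (sortKey s f) := by
  intro v w h
  have h' : (f v, if Even (s + f v) then (v : ℤ) else -(v : ℤ)) =
      (f w, if Even (s + f w) then (w : ℤ) else -(w : ℤ)) := h
  rw [Prod.mk.injEq] at h'
  obtain ⟨h1, h2⟩ := h'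
  rw [h1] at h2
  split_ifs at h2 <;> · ext; omega

theorem sortKey_lt_iff {n : ℕ} (s : ℕ) (f : Fin n → ℕ) (v w : Fin n) :
    sortKey s f v < sortKey s f w ↔
      f v < f w ∨ f v = f w ∧ if Even (s + f v) then v < w else w < v := by
  unfold sortKey
  rw [Prod.Lex.toLex_lt_toLex]
  refine or_congr Iff.rfl (and_congr_right fun h => ?_)
  simp only at h
  rw [h]
  split_ifs
  · simp
  · simp

/-- The permutation listing the letters in the increasing order of their sorting keys. -/
def sortPerm {n : ℕ} (s : ℕ) (f : Fin n → ℕ) : Equiv.Perm (Fin n) := Tuple.sort (sortKey s f)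

theorem strictMono_sortPerm {n : ℕ} (s : ℕ) (f : Fin n → ℕ) :
    StrictMono (sortKey s f ∘ sortPerm s f) :=
  (Tuple.monotone_sort _).strictMono_of_injective
    ((sortKey_injective s f).comp (Equiv.injective _))

/-- The keys are distinct, so only one listing makes them increase. Products and coefficients of
sorting permutations are both computed by checking this criterion. -/
theorem sortPerm_eq_iff {n : ℕ} (s : ℕ) (f : Fin n → ℕ) (σ : Equiv.Perm (Fin n)) :
    sortPerm s f = σ ↔ StrictMono (sortKey s f ∘ σ) := by
  constructor
  · rintro rfl
    exact strictMono_sortPerm s f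
  · intro h
    have := Tuple.unique_monotone (f := sortKey s f) (strictMono_sortPerm s f).monotone h.monotone
    ext i
    exact congrArg _ (sortKey_injective s f (congrFun this i))

/-- The sum over all distributions of the letters to `k` alternating blocks of the sorting
permutations. -/
noncomputable def blockSum (n s k : ℕ) : GroupAlg n :=
  ∑ f : Fin n → Fin k, MonoidAlgebra.single (sortPerm s fun v => (f v : ℕ)) (1 : ℚ)

/-- The bijection that replaces each block of an alternating chain of `l` blocks by a chain of `k`
blocks, reversed when the block is descending. -/
def twist (t l k : ℕ) : Fin l × Fin k ≃ Fin (k * l) :=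
  ((Equiv.prodCongrRight fun y : Fin l =>
    if Even (t + (y : ℕ)) then Equiv.refl (Fin k) else Fin.revPerm).trans finProdFinEquiv).trans
      (finCongr (Nat.mul_comm l k))

theorem twist_val (t l k : ℕ) (y : Fin l) (e : Fin k) :
    (twist t l k (y, e) : ℕ) =
      (if Even (t + (y : ℕ)) then (e : ℕ) else k - 1 - e) + k * y := by
  unfold twist
  split_ifs with h
  · simp [h]
  · simp [h, Fin.val_rev]; omega

/-- A descending outer block reverses the chain of inner blocks inside it and must also flip their
directions: as `t + y + 1` is even, the label is congruent to `s - 1 - e` modulo 2. -/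
theorem even_twist_descending (s : ℕ) {t k y e : ℕ} (he : e < k) (hev : ¬ Even (t + y)) :
    Even (s + t * k + (k - 1 - e + k * y)) ↔ ¬ Even (s + e) := by
  obtain ⟨m, rfl⟩ := Nat.exists_eq_add_of_lt he
  rw [show e + m + 1 - 1 - e = m by omega]
  simp only [Nat.even_add, Nat.even_mul, Nat.not_even_one, iff_false] at hev ⊢
  tauto

/-- The second sorting orders the positions of the first word by the block `h`, and within a block
along or against the first word. Read on letters, this is lexicographic sorting by `h` at the
position of the letter and then by `f`, with the inner chain reversed in descending blocks: the
labels given by `twist`. -/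
theorem sortPerm_mul {n : ℕ} (s t k l : ℕ) (f : Fin n → Fin k) (h : Fin n → Fin l) :
    sortPerm s (fun v => (f v : ℕ)) * sortPerm t (fun v => (h v : ℕ)) =
      sortPerm (s + t * k) (fun v => (twist t l k
        (h ((sortPerm s fun v => (f v : ℕ)).symm v), f v) : ℕ)) := by
  symm
  rw [sortPerm_eq_iff]
  intro p q hpq
  have h2 := strictMono_sortPerm t (fun v => (h v : ℕ)) hpq
  set σ := sortPerm s fun v => (f v : ℕ) with hσ
  set τ := sortPerm t fun v => (h v : ℕ) with hτ
  have h1 : ∀ i j, i < j → _ := fun i j hij => strictMono_sortPerm s (fun v => (f v : ℕ)) hij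
  rw [← hσ] at h1
  simp only [Function.comp_apply, sortKey_lt_iff] at h1 h2 ⊢
  simp only [Equiv.Perm.coe_mul, Function.comp_apply, Equiv.symm_apply_apply, twist_val]
  have b1 := (f (σ (τ p))).isLt
  have b2 := (f (σ (τ q))).isLt
  generalize hy : (h (τ p) : ℕ) = y at *
  generalize hy' : (h (τ q) : ℕ) = y' at *
  rcases h2 with h2 | ⟨h2, h3⟩
  · left
    have : k * (y + 1) ≤ k * y' := Nat.mul_le_mul_left _ h2
    rw [mul_add] at this
    split_ifs <;> omega
  · subst h2
    by_cases hev : Even (t + y)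
    · simp only [hev, if_true] at h3 ⊢
      rcases h1 _ _ h3 with h4 | ⟨h4, h5⟩
      · left; omega
      · right
        refine ⟨by omega, ?_⟩
        have e1 : Even (s + t * k + ((f (σ (τ p)) : ℕ) + k * y)) ↔ Even (s + (f (σ (τ p)) : ℕ)) := by
          rw [show s + t * k + ((f (σ (τ p)) : ℕ) + k * y) = s + (f (σ (τ p)) : ℕ) + (t + y) * k by
            ring, Nat.even_add]
          have : Even ((t + y) * k) := hev.mul_right k
          tauto
        simp only [e1]
        exact h5
    · simp only [hev, if_false] at h3 ⊢
      rcases h1 _ _ h3 with h4 | ⟨h4, h5⟩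
      · left; omega
      · right
        refine ⟨by omega, ?_⟩
        have e3 := even_twist_descending s (f (σ (τ p))).isLt hev
        rw [h4] at *
        split_ifs at h5 ⊢ with c1 c2 c2
        · tauto
        · exact h5
        · exact h5
        · tauto

theorem blockSum_mul (n s t k l : ℕ) :
    blockSum n s k * blockSum n t l = blockSum n (s + t * k) (k * l) := by
  unfold blockSum
  rw [Finset.sum_mul_sum]
  simp only [MonoidAlgebra.single_mul_single, sortPerm_mul, mul_one]
  have key : ∀ f : Fin n → Fin k,
      (∑ h : Fin n → Fin l, MonoidAlgebra.single (sortPerm (s + t * k) (fun v => (twist t l k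
        (h ((sortPerm s fun v => (f v : ℕ)).symm v), f v) : ℕ))) (1 : ℚ)) =
      ∑ h : Fin n → Fin l, MonoidAlgebra.single (sortPerm (s + t * k) (fun v => (twist t l k
        (h v, f v) : ℕ))) (1 : ℚ) := fun f =>
    -- For fixed `f` the first permutation is fixed, so `h` may be replaced by its composite with
    -- the inverse permutation.
    Equiv.sum_comp (Equiv.arrowCongr (sortPerm s fun v => (f v : ℕ)) (Equiv.refl (Fin l)))
      (fun h : Fin n → Fin l => MonoidAlgebra.single (sortPerm (s + t * k) (fun v => (twist t l k
        (h v, f v) : ℕ))) (1 : ℚ))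
  rw [Finset.sum_congr rfl fun f _ => key f, Finset.sum_comm, ← Fintype.sum_prod_type']
  exact Equiv.sum_comp ((Equiv.arrowProdEquivProdArrow _ _ _).symm.trans
    (Equiv.arrowCongr (Equiv.refl (Fin n)) (twist t l k)))
    (fun F : Fin n → Fin (k * l) => MonoidAlgebra.single (sortPerm (s + t * k) fun v => (F v : ℕ)) (1 : ℚ))

theorem blockSum_one_block (n : ℕ) : blockSum n 0 1 = 1 := by
  unfold blockSum
  rw [Fintype.sum_subsingleton _ (fun _ => 0), MonoidAlgebra.one_def]
  congr 1
  rw [sortPerm_eq_iff]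
  intro p q h
  simp only [Function.comp_apply, sortKey_lt_iff]
  simpa using h

/-! ### The transfer operators -/

/-- One step of the transfer recursion, descending when `d` is true. -/
def stepOp (s : ℕ) (d : Bool) (c : ℕ → ℚ) (b : ℕ) : ℚ :=
  (∑ a ∈ Finset.range b, c a) + if d = true ↔ ¬ Even (s + b) then c b else 0

/-- The number of ways to cut a word of `j + 1` letters with descent set `D` into alternating
monotone blocks, the last letter lying in the block `b`. -/
def lastBlock (s : ℕ) (D : Finset ℕ) : ℕ → ℕ → ℚ
  | 0 => fun _ => 1
  | j + 1 => stepOp s (decide (j + 1 ∈ D)) (lastBlock s D j)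

/-- The block labels of the letters weakly increase, and the blocks are monotone. -/
def Admissible (s : ℕ) (D : Finset ℕ) {m k : ℕ} (g : Fin (m + 1) → Fin k) : Prop :=
  ∀ i : Fin m, g i.castSucc < g i.succ ∨
    g i.castSucc = g i.succ ∧ ((i : ℕ) + 1 ∈ D ↔ ¬ Even (s + (g i.castSucc : ℕ)))

theorem admissible_snoc (s : ℕ) (D : Finset ℕ) {m k : ℕ} (g : Fin (m + 1) → Fin k) (b : Fin k) :
    Admissible s D (Fin.snoc g b : Fin (m + 2) → Fin k) ↔ Admissible s D g ∧
      (g (Fin.last m) < b ∨ g (Fin.last m) = b ∧ (m + 1 ∈ D ↔ ¬ Even (s + (b : ℕ)))) := by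
  unfold Admissible
  rw [Fin.forall_fin_succ']
  refine and_congr (forall_congr' fun i => ?_) ?_
  · rw [Fin.snoc_castSucc, Fin.succ_castSucc, Fin.snoc_castSucc, Fin.val_castSucc]
  · rw [Fin.snoc_castSucc, Fin.succ_last, Fin.snoc_last, Fin.val_last]
    exact or_congr Iff.rfl (and_congr_right fun h => by rw [h])

open Classical in
-- Deleting the last letter leaves an admissible labelling whose last block is earlier, or is the
-- same one if the new step has the direction of the block. This is the recursion of `stepOp`.
theorem sum_admissible_last (s : ℕ) (D : Finset ℕ) (k m : ℕ) (b : Fin k) :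
    (∑ g : Fin (m + 1) → Fin k, if Admissible s D g ∧ g (Fin.last m) = b then (1 : ℚ) else 0) =
      lastBlock s D m b := by
  induction m generalizing b with
  | zero =>
    have : ∀ g : Fin (0 + 1) → Fin k, Admissible s D g := fun g i => i.elim0
    simp only [this, true_and]
    rw [Fintype.sum_eq_single (fun _ => b) fun g hg => if_neg fun h => hg (funext fun i => by
      rw [show i = Fin.last 0 from Fin.ext (by simp), h]), if_pos rfl, lastBlock]
  | succ m ih =>
    rw [← Equiv.sum_comp (Fin.snocEquiv fun _ => Fin k), Fintype.sum_prod_type]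
    have h0 : ∀ (c : Fin k) (g : Fin (m + 1) → Fin k),
        Admissible s D ((Fin.snocEquiv fun _ => Fin k) (c, g)) ↔ Admissible s D g ∧
          (g (Fin.last m) < c ∨ g (Fin.last m) = c ∧ (m + 1 ∈ D ↔ ¬ Even (s + (c : ℕ)))) :=
      fun c g => admissible_snoc s D g c
    have h0' : ∀ (c : Fin k) (g : Fin (m + 1) → Fin k),
        ((Fin.snocEquiv fun _ => Fin k) (c, g) : Fin (m + 2) → Fin k) (Fin.last (m + 1)) = c :=
      fun c g => Fin.snoc_last (α := fun _ => Fin k) c g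
    simp only [h0, h0']
    have h1 : ∀ c : Fin k, c ≠ b → (∑ g : Fin (m + 1) → Fin k, if (Admissible s D g ∧
        (g (Fin.last m) < c ∨ g (Fin.last m) = c ∧ (m + 1 ∈ D ↔ ¬ Even (s + (c : ℕ))))) ∧ c = b
        then (1 : ℚ) else 0) = 0 := fun c hc => by simp [hc]
    rw [Finset.sum_eq_single b (fun c _ hc => h1 c hc) (by simp)]
    simp only [and_true]
    have h2 : ∀ g : Fin (m + 1) → Fin k, (if Admissible s D g ∧
        (g (Fin.last m) < b ∨ g (Fin.last m) = b ∧ (m + 1 ∈ D ↔ ¬ Even (s + (b : ℕ))))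
        then (1 : ℚ) else 0) = ∑ a : Fin k, (if a < b ∨ a = b ∧ (m + 1 ∈ D ↔ ¬ Even (s + (b : ℕ)))
        then 1 else 0) * if Admissible s D g ∧ g (Fin.last m) = a then 1 else 0 := by
      intro g
      rw [Finset.sum_eq_single (g (Fin.last m)) (fun a _ ha => by simp [ha.symm]) (by simp)]
      by_cases h : Admissible s D g <;> simp [h]
    rw [Finset.sum_congr rfl fun g _ => h2 g, Finset.sum_comm]
    simp only [← Finset.mul_sum, ih]
    rw [lastBlock, stepOp]
    have h3 : ∀ a : Fin k, (if a < b ∨ a = b ∧ (m + 1 ∈ D ↔ ¬ Even (s + (b : ℕ)))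
        then (1 : ℚ) else 0) * lastBlock s D m a =
        (if a < b then lastBlock s D m a else 0) +
          if a = b then (if m + 1 ∈ D ↔ ¬ Even (s + (b : ℕ)) then lastBlock s D m b else 0) else 0 := by
      intro a
      by_cases hab : a = b
      · subst hab; simp
      · simp [hab]
    rw [Finset.sum_congr rfl fun a _ => h3 a, Finset.sum_add_distrib]
    congr 1
    · simp only [Fin.lt_def]
      rw [Fin.sum_univ_eq_sum_range (fun a => if a < (b : ℕ) then lastBlock s D m a else 0),
        ← Finset.sum_filter]
      refine Finset.sum_congr ?_ fun _ _ => rfl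
      ext a
      have := b.isLt
      simp only [Finset.mem_filter, Finset.mem_range]
      omega
    · simp

open Classical in
theorem sum_admissible (s : ℕ) (D : Finset ℕ) (k m : ℕ) :
    (∑ g : Fin (m + 1) → Fin k, if Admissible s D g then (1 : ℚ) else 0) =
      ∑ b ∈ Finset.range k, lastBlock s D m b := by
  rw [← Fin.sum_univ_eq_sum_range]
  simp only [← sum_admissible_last]
  rw [Finset.sum_comm]
  refine Finset.sum_congr rfl fun g _ => ?_
  by_cases h : Admissible s D g <;> simp [h]

theorem mem_descents_iff {m : ℕ} (σ : Equiv.Perm (Fin (m + 1))) (i : Fin m) :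
    (i : ℕ) + 1 ∈ descents σ ↔ σ i.succ < σ i.castSucc := by
  have := i.isLt
  simp only [descents, Finset.mem_filter, Finset.mem_Ico]
  constructor
  · rintro ⟨_, h1, h2, h3⟩
    exact h3
  · intro h
    exact ⟨⟨by omega, by omega⟩, by omega, by omega, h⟩

/-- A labelling of the letters sorts to `σ` exactly when, read along the word of `σ`, it is
admissible for the descents of `σ`. -/
theorem coeff_blockSum (m s k : ℕ) (σ : Equiv.Perm (Fin (m + 1))) :
    (blockSum (m + 1) s k).coeff σ = ∑ b ∈ Finset.range k, lastBlock s (descents σ) m b := by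
  classical
  rw [← sum_admissible]
  unfold blockSum
  rw [MonoidAlgebra.coeff_sum, Finset.sum_apply']
  rw [← Equiv.sum_comp (Equiv.arrowCongr σ (Equiv.refl (Fin k)))]
  refine Finset.sum_congr rfl fun g _ => ?_
  rw [MonoidAlgebra.coeff_single, Finsupp.single_apply]
  refine if_congr ?_ rfl rfl
  rw [sortPerm_eq_iff, Fin.strictMono_iff_lt_succ]
  refine forall_congr' fun i => ?_
  simp only [Function.comp_apply, sortKey_lt_iff, Equiv.arrowCongr_apply, Equiv.symm_apply_apply,
    Equiv.coe_refl, id, mem_descents_iff, Fin.val_inj, Fin.val_fin_lt]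
  refine or_congr Iff.rfl (and_congr_right fun _ => ?_)
  have hne : σ i.castSucc ≠ σ i.succ := by
    rw [σ.injective.ne_iff]
    exact (Fin.castSucc_lt_succ).ne
  split_ifs with h
  · simp only [h, not_true, iff_false, not_lt]
    exact ⟨le_of_lt, fun h => lt_of_le_of_ne h hne⟩
  · simp only [h, not_false_iff, iff_true]

/-! ### Words acting on intervals -/

theorem mem_wordDescents {w : FreeMonoid ℕ+} {p : ℕ} : p ∈ wordDescents w ↔
    ∃ k, 1 ≤ k ∧ k < w.toList.length ∧ ((w.toList.take k).map (fun i : ℕ+ => (i : ℕ))).sum = p := by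
  simp [wordDescents, and_assoc]

theorem degree_of_mul (a : ℕ+) (w : FreeMonoid ℕ+) :
    degree (FreeMonoid.of a * w) = a + degree w := by
  simp [degree, FreeMonoid.toList_mul]

theorem mem_wordDescents_of_mul {a : ℕ+} {w : FreeMonoid ℕ+} {p : ℕ} :
    p ∈ wordDescents (FreeMonoid.of a * w) ↔
      (w ≠ 1 ∧ p = a) ∨ ∃ q ∈ wordDescents w, p = a + q := by
  have hw : w ≠ 1 ↔ 0 < w.toList.length := by
    rw [List.length_pos_iff_ne_nil]
    exact Iff.rfl
  simp only [mem_wordDescents, FreeMonoid.toList_mul, FreeMonoid.toList_of, List.singleton_append,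
    List.length_cons, hw]
  constructor
  · rintro ⟨k, h1, h2, h3⟩
    obtain ⟨k, rfl⟩ := Nat.exists_eq_add_of_le' h1
    simp only [List.take_succ_cons, List.map_cons, List.sum_cons] at h3
    rcases Nat.eq_zero_or_pos k with rfl | hk
    · left
      simp only [List.take_zero, List.map_nil, List.sum_nil, add_zero] at h3
      exact ⟨by omega, h3.symm⟩
    · exact Or.inr ⟨_, ⟨k, hk, by omega, rfl⟩, h3.symm⟩
  · rintro (⟨h1, rfl⟩ | ⟨q, ⟨k, h1, h2, rfl⟩, rfl⟩)
    · exact ⟨1, le_rfl, by omega, by simp⟩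
    · exact ⟨k + 1, by omega, by omega, by simp⟩

/-- The action of the letter `a`: the intervals of length `a` without a point of `D` inside. -/
def letterInterval (D : Finset ℕ) (a : ℕ+) : IncidenceAlgebra ℚ ℕ where
  toFun i j := if i + a = j ∧ ∀ p ∈ D, ¬ (i < p ∧ p < j) then 1 else 0
  eq_zero_of_not_le' i j h := if_neg fun h' => h (by omega)

/-- The representation of noncommutative symmetric functions on the intervals of `ℕ` given by a set
of descents. -/
noncomputable def intervalRep (D : Finset ℕ) : NSym →ₐ[ℚ] IncidenceAlgebra ℚ ℕ :=
  MonoidAlgebra.lift ℚ _ _ (FreeMonoid.lift (letterInterval D))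

/-- A word cuts an interval into consecutive pieces whose lengths are its letters. No piece may have
a point of `D` inside, so every inner point of `D` must be a cut. -/
theorem lift_letterInterval (D : Finset ℕ) (w : FreeMonoid ℕ+) (i j : ℕ) :
    FreeMonoid.lift (letterInterval D) w i j =
      if i + degree w = j ∧ ∀ p ∈ D, i < p → p < j → p - i ∈ wordDescents w then 1 else 0 := by
  induction w using FreeMonoid.inductionOn' generalizing i with
  | one =>
    rw [map_one, IncidenceAlgebra.one_apply]
    refine if_congr ⟨fun h => ⟨by simpa [degree] using h, fun p _ h1 h2 => by omega⟩,
      fun h => by simpa [degree] using h.1⟩ rfl rfl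
  | of_mul a w ih =>
    rw [map_mul, FreeMonoid.lift_eval_of, IncidenceAlgebra.mul_apply]
    have h0 : ∀ x, letterInterval D a i x =
        if i + a = x ∧ ∀ p ∈ D, ¬ (i < p ∧ p < x) then 1 else 0 := fun x => rfl
    rw [Finset.sum_eq_single (i + a : ℕ), h0, ih]
    · rw [ite_zero_mul_ite_zero, degree_of_mul, mul_one]
      refine if_congr ?_ rfl rfl
      constructor
      · rintro ⟨⟨-, h1⟩, h2, h3⟩
        refine ⟨by omega, fun p hp h4 h5 => ?_⟩
        rw [mem_wordDescents_of_mul]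
        rcases lt_trichotomy p (i + a) with h | h | h
        · exact absurd ⟨h4, h⟩ (h1 p hp)
        · left
          refine ⟨?_, by omega⟩
          rintro rfl
          simp [degree] at h2
          omega
        · exact Or.inr ⟨_, h3 p hp h h5, by omega⟩
      · rintro ⟨h1, h2⟩
        refine ⟨⟨rfl, ?_⟩, by omega, fun p hp h4 h5 => ?_⟩
        · rintro p hp ⟨h4, h5⟩
          have := h2 p hp h4 (by omega)
          rw [mem_wordDescents_of_mul] at this
          rcases this with ⟨_, h⟩ | ⟨q, _, h⟩ <;> omega
        · have := h2 p hp (by omega) h5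
          rw [mem_wordDescents_of_mul] at this
          rcases this with ⟨_, h⟩ | ⟨q, hq, h⟩
          · omega
          · rwa [show p - (i + a) = q by omega]
    · intro x _ hx
      rw [h0, if_neg (fun h => hx h.1.symm), zero_mul]
    · intro hx
      rw [ih, if_neg, mul_zero]
      rintro ⟨h, _⟩
      exact hx (Finset.mem_Icc.2 ⟨by omega, by omega⟩)

/-- All descents lie strictly between `0` and `n`, so on the interval from `0` to `n` the cutting
condition becomes `Des σ ⊆ Des w`. Since `intervalRep` is multiplicative, coefficients of
`⋆`-products can now be computed by convolution. -/
theorem coeff_toGroupAlg (n : ℕ) (F : NSym) (σ : Equiv.Perm (Fin n)) :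
    (toGroupAlg n F).coeff σ = intervalRep (descents σ) F 0 n := by
  classical
  have h : ∀ F : NSym, toGroupAlg n F = F.coeff.sum fun w b =>
      b • (if degree w = n then completeSum n w else 0) := fun F => rfl
  have ev : ∀ F : NSym, intervalRep (descents σ) F 0 n =
      F.coeff.sum fun w b => b * FreeMonoid.lift (letterInterval (descents σ)) w 0 n := by
    intro F
    rw [intervalRep, MonoidAlgebra.lift_apply, Finsupp.sum, Finsupp.sum]
    induction F.coeff.support using Finset.induction_on with
    | empty => simp
    | insert a s ha ih => rw [Finset.sum_insert ha, Finset.sum_insert ha,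
        IncidenceAlgebra.add_apply, ih]; rfl
  rw [h, ev, MonoidAlgebra.coeff_finsuppSum, Finsupp.sum, Finsupp.sum, Finset.sum_apply']
  refine Finset.sum_congr rfl fun w _ => ?_
  rw [MonoidAlgebra.coeff_smul_apply, smul_eq_mul, lift_letterInterval]
  congr 1
  by_cases hw : degree w = n
  · rw [if_pos hw, completeSum, MonoidAlgebra.coeff_sum, Finset.sum_apply']
    simp only [MonoidAlgebra.coeff_single, Finsupp.single_apply]
    rw [Finset.sum_ite_eq']
    refine if_congr ?_ rfl rfl
    simp only [Finset.mem_filter, Finset.mem_univ, true_and, zero_add, hw, Nat.sub_zero]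
    constructor
    · exact fun h p hp _ _ => h hp
    · intro h p hp
      have hp' := hp
      simp only [descents, Finset.mem_filter, Finset.mem_Ico] at hp'
      exact h p hp (by omega) (by omega)
  · rw [if_neg hw, if_neg (fun h => hw (by omega))]
    rfl

/-! ### Power series over a noncommutative ring -/

/-- The substitution `X ↦ -X`. -/
noncomputable def negX (R : Type*) [Ring R] : PowerSeries R →+* PowerSeries R where
  toFun F := PowerSeries.mk fun n => (-1) ^ n * PowerSeries.coeff n F
  map_one' := by
    ext n
    rw [PowerSeries.coeff_mk, PowerSeries.coeff_one]
    split_ifs with h <;> simp [h]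
  map_zero' := by ext n; simp
  map_add' F G := by ext n; simp [mul_add]
  map_mul' F G := by
    ext n
    simp only [PowerSeries.coeff_mk, PowerSeries.coeff_mul, Finset.mul_sum]
    refine Finset.sum_congr rfl fun p hp => ?_
    rw [← Finset.HasAntidiagonal.mem_antidiagonal.1 hp, pow_add, mul_assoc, mul_assoc]
    congr 1
    rw [← mul_assoc, ← mul_assoc, ((Commute.neg_one_left _).pow_left _).eq]

theorem coeff_negX {R : Type*} [Ring R] (n : ℕ) (F : PowerSeries R) :
    PowerSeries.coeff n (negX R F) = (-1) ^ n * PowerSeries.coeff n F := by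
  simp only [negX, RingHom.coe_mk, MonoidHom.coe_mk, OneHom.coe_mk, PowerSeries.coeff_mk]

theorem isUnit_of_constantCoeff_eq_one {R : Type*} [Ring R] {F : PowerSeries R}
    (h : PowerSeries.constantCoeff F = 1) : IsUnit F :=
  ⟨⟨F, PowerSeries.invOfUnit F 1, PowerSeries.mul_invOfUnit F 1 h,
    PowerSeries.invOfUnit_mul F 1 h⟩, rfl⟩

theorem mul_eq_one_of_constantCoeff {R : Type*} [Ring R] {F G : PowerSeries R}
    (h : PowerSeries.constantCoeff F = 1) (hFG : F * G = 1) : G * F = 1 := by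
  obtain ⟨u, rfl⟩ := isUnit_of_constantCoeff_eq_one h
  rw [← Units.inv_eq_of_mul_eq_one_right hFG, Units.inv_mul]

/-! ### The series `V₁⁻` is the inverse of `V₁⁺(-X)` -/

theorem coeff_V1minus (n : ℕ) : PowerSeries.coeff n V1minus =
    ∑ J : Composition n, ((-1 : ℚ) ^ (n - J.length)) • complete J := by
  unfold V1minus ribbon
  rw [PowerSeries.coeff_mk, Composition.ones_length]
  refine Finset.sum_congr ?_ fun _ _ => rfl
  ext J
  simp only [Finset.mem_filter, Finset.mem_univ, true_and, iff_true]
  have : (Composition.ones n).boundaries = Finset.univ := by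
    rw [← Finset.card_eq_iff_eq_univ, Composition.card_boundaries_eq_succ_length]
    simp
  rw [this]
  exact Finset.subset_univ _

/-- The composition with first part `a + 1` followed by the parts of a composition of `n - a`. -/
def consComposition (n : ℕ) (x : Σ a : Fin (n + 1), Composition (n - a)) : Composition (n + 1) where
  blocks := ((x.1 : ℕ) + 1) :: x.2.blocks
  blocks_pos := by
    intro i hi
    rcases List.mem_cons.1 hi with rfl | hi
    · omega
    · exact x.2.blocks_pos hi
  blocks_sum := by
    rw [List.sum_cons, x.2.blocks_sum]
    omega

theorem consComposition_bijective (n : ℕ) : Function.Bijective (consComposition n) := by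
  constructor
  · rintro ⟨a, J⟩ ⟨b, K⟩ h
    have h' := congrArg Composition.blocks h
    simp only [consComposition, List.cons.injEq, Nat.add_right_cancel_iff] at h'
    obtain ⟨h1, h2⟩ := h'
    obtain rfl := Fin.ext h1
    rw [Composition.ext h2]
  · intro c
    rcases hb : c.blocks with _ | ⟨a, l⟩
    · exact absurd (c.blocks_eq_nil.1 hb) (by omega)
    · have hpos : 0 < a := c.blocks_pos (by rw [hb]; exact List.mem_cons_self)
      have hsum := c.blocks_sum
      rw [hb, List.sum_cons] at hsum
      refine ⟨⟨⟨a - 1, by omega⟩, ⟨l, fun {i} hi => c.blocks_pos (by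
        rw [hb]; exact List.mem_cons_of_mem _ hi), ?_⟩⟩, ?_⟩
      · change l.sum = n - (a - 1)
        omega
      · refine Composition.ext (Eq.trans ?_ hb.symm)
        change (a - 1 + 1) :: l = a :: l
        rw [Nat.sub_add_cancel hpos]

/-- Split off the first part `a + 1` of a composition: it uses up `a + 1` of the size and `1` of the
length, whence the sign. -/
theorem coeff_succ_V1minus (n : ℕ) : PowerSeries.coeff (n + 1) V1minus =
    ∑ a ∈ Finset.range (n + 1), ((-1 : ℚ) ^ a) • (S (a + 1) * PowerSeries.coeff (n - a) V1minus) := by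
  rw [coeff_V1minus, ← (consComposition_bijective n).sum_comp, Fintype.sum_sigma,
    ← Fin.sum_univ_eq_sum_range (fun a =>
      ((-1 : ℚ) ^ a) • (S (a + 1) * PowerSeries.coeff (n - a) V1minus))]
  refine Finset.sum_congr rfl fun a _ => ?_
  rw [coeff_V1minus, Finset.mul_sum, Finset.smul_sum]
  refine Finset.sum_congr rfl fun J _ => ?_
  rw [mul_smul_comm, smul_smul, ← pow_add]
  have h1 : (consComposition n ⟨a, J⟩).length = J.length + 1 := rfl
  have h2 : complete (consComposition n ⟨a, J⟩) = S (a + 1) * complete J := by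
    simp [complete, consComposition]
  rw [h1, h2]
  have := J.length_le
  congr 2
  omega

theorem constantCoeff_V1plus : PowerSeries.constantCoeff V1plus = 1 := by
  rw [← PowerSeries.coeff_zero_eq_constantCoeff_apply]
  simp [V1plus, S]

theorem constantCoeff_V1minus : PowerSeries.constantCoeff V1minus = 1 := by
  rw [← PowerSeries.coeff_zero_eq_constantCoeff_apply, coeff_V1minus,
    Fintype.sum_eq_single (Composition.ones 0) fun J hJ => absurd
      (Composition.ext ((J.blocks_eq_nil.2 rfl).trans (Composition.blocks_eq_nil _ |>.2 rfl).symm)) hJ]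
  simp [complete]

theorem negX_V1plus_mul_V1minus : negX NSym V1plus * V1minus = 1 := by
  ext1 n
  rw [PowerSeries.coeff_one]
  cases n with
  | zero =>
    rw [if_pos rfl, PowerSeries.coeff_zero_eq_constantCoeff_apply, map_mul, constantCoeff_V1minus,
      mul_one, ← PowerSeries.coeff_zero_eq_constantCoeff_apply, coeff_negX, pow_zero, one_mul,
      PowerSeries.coeff_zero_eq_constantCoeff_apply, constantCoeff_V1plus]
  | succ n =>
    rw [if_neg (Nat.succ_ne_zero n), PowerSeries.coeff_mul, Finset.Nat.sum_antidiagonal_succ,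
      coeff_succ_V1minus,
      Finset.Nat.sum_antidiagonal_eq_sum_range_succ_mk, coeff_negX, pow_zero, one_mul,
      PowerSeries.coeff_zero_eq_constantCoeff_apply, constantCoeff_V1plus, one_mul,
      ← Finset.sum_add_distrib]
    refine Finset.sum_eq_zero fun a _ => ?_
    rw [coeff_negX]
    simp only [V1plus, PowerSeries.coeff_mk]
    rcases Nat.even_or_odd a with h | h
    · rw [h.neg_one_pow, h.add_one.neg_one_pow, one_smul]
      noncomm_ring
    · rw [h.neg_one_pow, h.add_one.neg_one_pow, neg_one_smul]
      noncomm_ring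

theorem V1minus_mul_negX_V1plus : V1minus * negX NSym V1plus = 1 := by
  refine mul_eq_one_of_constantCoeff ?_ negX_V1plus_mul_V1minus
  rw [← PowerSeries.coeff_zero_eq_constantCoeff_apply, coeff_negX, pow_zero, one_mul,
      PowerSeries.coeff_zero_eq_constantCoeff_apply, constantCoeff_V1plus]

theorem negX_negX {R : Type*} [Ring R] (F : PowerSeries R) : negX R (negX R F) = F := by
  ext1 n
  rw [coeff_negX, coeff_negX, ← mul_assoc, ← pow_add, (Even.add_self n).neg_one_pow, one_mul]

theorem negX_V1minus_mul_V1plus : negX NSym V1minus * V1plus = 1 := by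
  have := congrArg (negX NSym) V1minus_mul_negX_V1plus
  rwa [map_mul, negX_negX, map_one] at this

/-! ### The series on intervals -/

/-- An interval function, cut into its parts according to the lengths of the intervals. -/
noncomputable def grade : IncidenceAlgebra ℚ ℕ →+* PowerSeries (IncidenceAlgebra ℚ ℕ) where
  toFun v := PowerSeries.mk fun a =>
    ⟨fun i j => if i + a = j then v i j else 0, fun _ _ h => if_neg fun h' => h (by omega)⟩
  map_one' := by
    ext a i j hij
    rw [PowerSeries.coeff_mk, PowerSeries.coeff_one]
    by_cases ha : a = 0
    · subst ha
      simp
    · rw [if_neg ha]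
      simp only [IncidenceAlgebra.coe_mk, IncidenceAlgebra.one_apply, IncidenceAlgebra.zero_apply]
      split_ifs <;> first | rfl | omega
  map_zero' := by
    ext a i j hij
    simp
  map_add' v w := by
    ext a i j hij
    simp only [PowerSeries.coeff_mk, map_add, IncidenceAlgebra.coe_mk, IncidenceAlgebra.add_apply]
    split_ifs <;> simp
  map_mul' v w := by
    ext c i j hij
    have hs : ∀ (s : Finset (ℕ × ℕ)) (f : ℕ × ℕ → IncidenceAlgebra ℚ ℕ),
        (∑ x ∈ s, f x) i j = ∑ x ∈ s, f x i j := by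
      intro s f
      induction s using Finset.induction_on with
      | empty => rfl
      | insert a s ha ih => rw [Finset.sum_insert ha, Finset.sum_insert ha,
          IncidenceAlgebra.add_apply, ih]
    rw [PowerSeries.coeff_mul, hs]
    simp only [PowerSeries.coeff_mk, IncidenceAlgebra.mul_apply, IncidenceAlgebra.coe_mk,
      ite_zero_mul_ite_zero]
    rw [Finset.sum_comm]
    by_cases hc : i + c = j
    · rw [if_pos hc]
      refine Finset.sum_congr rfl fun x hx => ?_
      rw [Finset.mem_Icc] at hx
      rw [Finset.sum_eq_single (x - i, j - x), if_pos ⟨by omega, by omega⟩]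
      · rintro ⟨a, b⟩ _ hab
        refine if_neg fun h => hab ?_
        simp only at h
        ext <;> simp <;> omega
      · intro h
        exact absurd (Finset.HasAntidiagonal.mem_antidiagonal.2
          (show x - i + (j - x) = c by omega)) h
    · rw [if_neg hc]
      refine (Finset.sum_eq_zero fun x _ => Finset.sum_eq_zero fun p hp => if_neg ?_).symm
      rw [Finset.HasAntidiagonal.mem_antidiagonal] at hp
      omega

theorem coeff_grade (v : IncidenceAlgebra ℚ ℕ) (a i j : ℕ) :
    PowerSeries.coeff a (grade v) i j = if i + a = j then v i j else 0 := by
  simp [grade]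

open Classical in
/-- The intervals all of whose inner points satisfy `Q`. -/
noncomputable def innerInterval (Q : ℕ → Prop) : IncidenceAlgebra ℚ ℕ where
  toFun i j := if i ≤ j ∧ ∀ p, i < p → p < j → Q p then 1 else 0
  eq_zero_of_not_le' _ _ h := if_neg fun h' => h h'.1

open Classical in
/-- The steps `(i, i + 1)` with `Q i`. -/
noncomputable def stepInterval (Q : ℕ → Prop) : IncidenceAlgebra ℚ ℕ where
  toFun i j := if i + 1 = j ∧ Q i then 1 else 0
  eq_zero_of_not_le' _ _ h := if_neg fun h' => h (by omega)

theorem stepInterval_apply (Q : ℕ → Prop) [DecidablePred Q] (i j : ℕ) :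
    stepInterval Q i j = if i + 1 = j ∧ Q i then 1 else 0 := by
  simp only [stepInterval, IncidenceAlgebra.coe_mk]
  congr

open Classical in
theorem mul_stepInterval (v : IncidenceAlgebra ℚ ℕ) (Q : ℕ → Prop) (i j : ℕ) :
    (v * stepInterval Q) i (j + 1) = if Q j then v i j else 0 := by
  rw [IncidenceAlgebra.mul_apply]
  rw [Finset.sum_eq_single j, stepInterval_apply]
  · split_ifs <;> simp_all
  · intro x _ hx
    rw [stepInterval_apply, if_neg (by omega), mul_zero]
  · intro hj
    rw [IncidenceAlgebra.apply_eq_zero_of_not_le (a := i) (b := j), zero_mul]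
    intro hij
    exact hj (Finset.mem_Icc.2 ⟨hij, by omega⟩)

theorem mul_stepInterval_zero (v : IncidenceAlgebra ℚ ℕ) (Q : ℕ → Prop) (i : ℕ) :
    (v * stepInterval Q) i 0 = 0 := by
  rw [IncidenceAlgebra.mul_apply]
  refine Finset.sum_eq_zero fun x _ => ?_
  classical
  rw [stepInterval_apply, if_neg (by omega), mul_zero]

open Classical in
theorem innerInterval_apply_succ (Q : ℕ → Prop) (i j : ℕ) (hij : i ≤ j) :
    innerInterval Q i (j + 1) = if i = j ∨ Q j then innerInterval Q i j else 0 := by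
  have h : ∀ j, innerInterval Q i j = if i ≤ j ∧ ∀ p, i < p → p < j → Q p then 1 else 0 := fun j => rfl
  rw [h, h, ← ite_and]
  refine if_congr ?_ rfl rfl
  constructor
  · rintro ⟨h1, h2⟩
    refine ⟨?_, hij, fun p h3 h4 => h2 p h3 (by omega)⟩
    by_cases h5 : i = j
    · exact Or.inl h5
    · exact Or.inr (h2 j (by omega) (by omega))
  · rintro ⟨h1, h2, h3⟩
    refine ⟨by omega, fun p h4 h5 => ?_⟩
    rcases Nat.lt_succ_iff_lt_or_eq.1 h5 with h | rfl
    · exact h3 p h4 h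
    · rcases h1 with rfl | h1
      · omega
      · exact h1

theorem innerInterval_self (Q : ℕ → Prop) (i : ℕ) : innerInterval Q i i = 1 :=
  if_pos ⟨le_rfl, fun p h1 h2 => by omega⟩

/-- Extending an interval across an inner endpoint that satisfies `Q` does not change its value, so
the product telescopes. Only the trivial intervals and the unit steps from points violating `Q`
survive. -/
theorem innerInterval_mul_sub (Q : ℕ → Prop) :
    innerInterval Q * (1 - stepInterval Q) = 1 + stepInterval fun p => ¬ Q p := by
  classical
  ext i j hij
  rw [mul_sub, mul_one, IncidenceAlgebra.sub_apply, IncidenceAlgebra.add_apply,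
    IncidenceAlgebra.one_apply]
  rw [stepInterval_apply]
  cases j with
  | zero =>
    obtain rfl : i = 0 := by omega
    rw [mul_stepInterval_zero]
    simp [innerInterval_self]
  | succ j =>
    rw [mul_stepInterval]
    rcases Nat.lt_succ_iff_lt_or_eq.1 (Nat.lt_succ_of_le hij) with h1 | rfl
    · rw [innerInterval_apply_succ Q i j (by omega)]
      by_cases h2 : i = j
      · subst h2
        by_cases hQ : Q i <;> simp [hQ, innerInterval_self]
      · have h3 : i ≠ j + 1 := by omega
        simp [h2, h3]
    · rw [innerInterval_self, IncidenceAlgebra.apply_eq_zero_of_not_le (by omega)]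
      simp

theorem intervalRep_S (D : Finset ℕ) (a i j : ℕ) :
    intervalRep D (S a) i j = if i + a = j then innerInterval (· ∉ D) i j else 0 := by
  classical
  have h : innerInterval (· ∉ D) i j = if i ≤ j ∧ ∀ p, i < p → p < j → p ∉ D then 1 else 0 := by
    simp only [innerInterval, IncidenceAlgebra.coe_mk]
  rcases Nat.eq_zero_or_pos a with rfl | ha
  · rw [S, dif_neg (lt_irrefl 0), map_one, IncidenceAlgebra.one_apply]
    split_ifs with h1 h2 h2
    · subst h1; rw [innerInterval_self]
    · omega
    · omega
    · rfl
  · rw [S, dif_pos ha, intervalRep, MonoidAlgebra.lift_single, one_smul]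
    refine (congrArg (fun v : IncidenceAlgebra ℚ ℕ => v i j)
      (FreeMonoid.lift_eval_of (letterInterval D) (⟨a, ha⟩ : ℕ+))).trans ?_
    rw [h, ← ite_and]
    refine if_congr ?_ rfl rfl
    constructor
    · rintro ⟨h1, h2⟩
      exact ⟨h1, by simp at h1; omega, fun p h3 h4 hp => h2 p hp ⟨h3, h4⟩⟩
    · rintro ⟨h1, h2, h3⟩
      exact ⟨h1, fun p hp h4 => h3 p h4.1 h4.2 hp⟩

theorem map_intervalRep_V1plus (D : Finset ℕ) :
    PowerSeries.map (intervalRep D : NSym →+* IncidenceAlgebra ℚ ℕ) V1plus =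
      grade (innerInterval (· ∉ D)) := by
  ext a i j _
  rw [PowerSeries.coeff_map, V1plus, PowerSeries.coeff_mk, coeff_grade]
  exact intervalRep_S D a i j

theorem map_negX {R R' : Type*} [Ring R] [Ring R'] (f : R →+* R') (F : PowerSeries R) :
    PowerSeries.map f (negX R F) = negX R' (PowerSeries.map f F) := by
  ext1 n
  simp only [PowerSeries.coeff_map, coeff_negX, map_mul, map_pow, map_neg, map_one]

theorem negX_eq_neg {R : Type*} [Ring R] {F : PowerSeries R}
    (h : ∀ a, a ≠ 1 → PowerSeries.coeff a F = 0) : negX R F = -F := by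
  ext1 a
  rw [coeff_negX, map_neg]
  by_cases ha : a = 1
  · rw [ha, pow_one, neg_one_mul]
  · rw [h a ha, mul_zero, neg_zero]

theorem negX_grade_stepInterval (Q : ℕ → Prop) :
    negX _ (grade (stepInterval Q)) = -grade (stepInterval Q) := by
  classical
  refine negX_eq_neg fun a ha => ?_
  ext i j _
  rw [coeff_grade, stepInterval_apply, IncidenceAlgebra.zero_apply, ← ite_and]
  exact if_neg fun h => ha (by omega)

theorem isUnit_grade_one_sub_stepInterval (Q : ℕ → Prop) :
    IsUnit (grade (1 - stepInterval Q)) := by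
  classical
  apply isUnit_of_constantCoeff_eq_one
  rw [← PowerSeries.coeff_zero_eq_constantCoeff_apply]
  ext i j _
  rw [coeff_grade, IncidenceAlgebra.sub_apply, IncidenceAlgebra.one_apply, stepInterval_apply]
  by_cases h : i = j
  · simp [h]
  · simp [h]

/-- `V₁⁻` is determined as the inverse of `V₁⁺(-X)`. Write `E`, `T` for `innerInterval`,
`stepInterval`. Changing `X` to `-X` in the identity for the complement of `D` gives `E(-X) (1 +
T_{∉D}) = 1 - T_{∈D}`, while the identity for `D` gives `E_{∈D} (1 - T_{∈D}) = 1 + T_{∉D}`. Hence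
the image of `V₁⁻` and `E_{∈D}` agree after multiplication by the unit `1 - T_{∈D}`. -/
theorem map_intervalRep_V1minus (D : Finset ℕ) :
    PowerSeries.map (intervalRep D : NSym →+* IncidenceAlgebra ℚ ℕ) V1minus =
      grade (innerInterval (· ∈ D)) := by
  have h1 := congrArg (PowerSeries.map (intervalRep D : NSym →+* IncidenceAlgebra ℚ ℕ))
    V1minus_mul_negX_V1plus
  rw [map_mul, map_negX, map_intervalRep_V1plus, map_one] at h1
  have h2 := congrArg (fun v => negX _ (grade v)) (innerInterval_mul_sub (· ∉ D))
  simp only [map_mul, map_sub, map_add, map_one, negX_grade_stepInterval, not_not,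
    sub_neg_eq_add] at h2
  have h3 := congrArg grade (innerInterval_mul_sub (· ∈ D))
  rw [map_mul] at h3
  rw [← (isUnit_grade_one_sub_stepInterval (· ∈ D)).mul_left_inj, h3, map_sub, map_one,
    sub_eq_add_neg, ← h2, ← mul_assoc, h1, one_mul, map_add, map_one]

/-! ### Alternating products -/

/-- The `⋆`-product of `k` series `V₁^±` with alternating signs, the first one being `+` when `s` is
even. -/
noncomputable def altSeries (s : ℕ) : ℕ → NSymHat
  | 0 => 1
  | k + 1 => altSeries s k * if Even (s + k) then V1plus else V1minus

/-- The interval function of the alternating product of `k` series. -/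
noncomputable def altInterval (s : ℕ) (D : Finset ℕ) : ℕ → IncidenceAlgebra ℚ ℕ
  | 0 => 1
  | k + 1 => altInterval s D k * innerInterval fun p => p ∈ D ↔ ¬ Even (s + k)

theorem map_intervalRep_altSeries (D : Finset ℕ) (s k : ℕ) :
    PowerSeries.map (intervalRep D : NSym →+* IncidenceAlgebra ℚ ℕ) (altSeries s k) =
      grade (altInterval s D k) := by
  induction k with
  | zero => rw [altSeries, altInterval, map_one, map_one]
  | succ k ih =>
    rw [altSeries, altInterval, map_mul, map_mul, ih]
    congr 1
    split_ifs with h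
    · simp only [h, map_intervalRep_V1plus, not_true, iff_false]
    · simp only [h, map_intervalRep_V1minus, not_false_eq_true, iff_true]

theorem altInterval_zero (s : ℕ) (D : Finset ℕ) (k : ℕ) : altInterval s D k 0 0 = 1 := by
  induction k with
  | zero => rfl
  | succ k ih =>
    rw [altInterval, IncidenceAlgebra.mul_apply]
    simp [ih, innerInterval_self]

theorem altInterval_succ (s : ℕ) (D : Finset ℕ) (k j : ℕ) :
    altInterval s D (k + 1) 0 (j + 1) = altInterval s D k 0 (j + 1) + altInterval s D k 0 j +
      if j ∈ D ↔ ¬ Even (s + k) then altInterval s D (k + 1) 0 j - altInterval s D k 0 j else 0 := by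
  have h := congrArg (fun v => (altInterval s D k * v) 0 (j + 1))
    (innerInterval_mul_sub fun p => p ∈ D ↔ ¬ Even (s + k))
  simp only [← mul_assoc] at h
  rw [show altInterval s D k * innerInterval (fun p => p ∈ D ↔ ¬ Even (s + k)) =
    altInterval s D (k + 1) from rfl, mul_sub, mul_add, mul_one, mul_one, IncidenceAlgebra.sub_apply,
    IncidenceAlgebra.add_apply, mul_stepInterval, mul_stepInterval] at h
  by_cases hj : j ∈ D ↔ ¬ Even (s + k)
  · simp only [hj, if_true, not_true, if_false] at h ⊢
    linarith
  · simp only [hj, if_false, not_false_eq_true, if_true] at h ⊢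
    linarith

/-- Both sides satisfy the same recursion in the length of the word and the number of blocks;
`altInterval_succ` is the summed form of `stepOp`. -/
theorem altInterval_eq_sum (s : ℕ) (D : Finset ℕ) (m k : ℕ) :
    altInterval s D k 0 (m + 1) = ∑ b ∈ Finset.range k, lastBlock s D m b := by
  induction m generalizing k with
  | zero =>
    induction k with
    | zero => rfl
    | succ k ih =>
      rw [altInterval_succ, ih, altInterval_zero, altInterval_zero, Finset.sum_range_succ]
      simp [lastBlock]
  | succ m ihm =>
    induction k with
    | zero => rfl
    | succ k ih =>
      rw [altInterval_succ, ih, ihm, ihm, Finset.sum_range_succ (fun b => lastBlock s D m b),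
        add_sub_cancel_left, Finset.sum_range_succ, lastBlock, stepOp, add_assoc]
      simp only [decide_eq_true_eq]

theorem degreePart_altSeries (n s k : ℕ) :
    degreePart (n + 1) (altSeries s k) = blockSum (n + 1) s k := by
  refine MonoidAlgebra.coeff_injective (Finsupp.ext fun σ => ?_)
  rw [degreePart, coeff_toGroupAlg, coeff_blockSum, ← altInterval_eq_sum]
  have h := congrArg (fun F : PowerSeries (IncidenceAlgebra ℚ ℕ) =>
    PowerSeries.coeff (n + 1) F 0 (n + 1))
    (map_intervalRep_altSeries (descents σ) s k)
  simp only [PowerSeries.coeff_map, coeff_grade, zero_add, if_true] at h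
  exact h

/-! ### Formal substitution in a noncommutative series -/

theorem coeff_pow_mul_eq_zero {R : Type*} [Ring R] {F : PowerSeries R}
    (hF : PowerSeries.constantCoeff F = 0) {n j : ℕ} (h : n < j) (H : PowerSeries R) :
    PowerSeries.coeff n (F ^ j * H) = 0 := by
  induction j generalizing n with
  | zero => omega
  | succ j ih =>
    rw [pow_succ', mul_assoc, PowerSeries.coeff_mul]
    refine Finset.sum_eq_zero fun p hp => ?_
    rw [Finset.HasAntidiagonal.mem_antidiagonal] at hp
    rcases Nat.eq_zero_or_pos p.1 with h0 | h0
    · rw [h0, PowerSeries.coeff_zero_eq_constantCoeff_apply, hF, zero_mul]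
    · rw [ih (by omega), mul_zero]

theorem coeff_pow_eq_zero {R : Type*} [Ring R] {F : PowerSeries R}
    (hF : PowerSeries.constantCoeff F = 0) {n j : ℕ} (h : n < j) :
    PowerSeries.coeff n (F ^ j) = 0 := by
  simpa using coeff_pow_mul_eq_zero hF h 1

theorem coeff_mul_pow_eq_zero {R : Type*} [Ring R] {F : PowerSeries R}
    (hF : PowerSeries.constantCoeff F = 0) {n j : ℕ} (h : n < j) (H : PowerSeries R) :
    PowerSeries.coeff n (H * F ^ j) = 0 := by
  rw [PowerSeries.coeff_mul]
  refine Finset.sum_eq_zero fun p hp => ?_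
  rw [Finset.HasAntidiagonal.mem_antidiagonal] at hp
  rw [coeff_pow_eq_zero hF (by omega), mul_zero]

/-- The truncation bound is free, so that several substitutions can be expanded over a common range.
-/
theorem coeff_substStar {F : NSymHat} (hF : PowerSeries.constantCoeff F = 0) (c : ℕ → ℚ)
    {n N : ℕ} (h : n ≤ N) : PowerSeries.coeff n (substStar c F) =
      ∑ j ∈ Finset.range (N + 1), c j • PowerSeries.coeff n (F ^ j) := by
  rw [substStar, PowerSeries.coeff_mk]
  refine Finset.sum_subset (Finset.range_mono (by omega)) fun j _ hj => ?_
  rw [Finset.mem_range] at hj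
  rw [coeff_pow_eq_zero hF (by omega), smul_zero]

theorem coeff_substStar_mul {F : NSymHat} (hF : PowerSeries.constantCoeff F = 0) (c : ℕ → ℚ)
    (H : NSymHat) {n N : ℕ} (h : n ≤ N) : PowerSeries.coeff n (substStar c F * H) =
      ∑ j ∈ Finset.range (N + 1), c j • PowerSeries.coeff n (F ^ j * H) := by
  simp only [PowerSeries.coeff_mul, Finset.smul_sum]
  rw [Finset.sum_comm]
  refine Finset.sum_congr rfl fun p hp => ?_
  rw [Finset.HasAntidiagonal.mem_antidiagonal] at hp
  rw [coeff_substStar hF c (N := N) (by omega), Finset.sum_mul]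
  simp only [smul_mul_assoc]

theorem coeff_mul_substStar {F : NSymHat} (hF : PowerSeries.constantCoeff F = 0) (c : ℕ → ℚ)
    (H : NSymHat) {n N : ℕ} (h : n ≤ N) : PowerSeries.coeff n (H * substStar c F) =
      ∑ j ∈ Finset.range (N + 1), c j • PowerSeries.coeff n (H * F ^ j) := by
  simp only [PowerSeries.coeff_mul, Finset.smul_sum]
  rw [Finset.sum_comm]
  refine Finset.sum_congr rfl fun p hp => ?_
  rw [Finset.HasAntidiagonal.mem_antidiagonal] at hp
  rw [coeff_substStar hF c (N := N) (by omega), Finset.mul_sum]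
  simp only [mul_smul_comm]

/-- Intertwining passes from a series to its powers and so to every series in it. It will move `H`
past logarithms and fractional powers. -/
theorem substStar_mul_eq {F F' H : NSymHat} (hF : PowerSeries.constantCoeff F = 0)
    (hF' : PowerSeries.constantCoeff F' = 0) (h : F * H = H * F') (c : ℕ → ℚ) :
    substStar c F * H = H * substStar c F' := by
  ext1 n
  rw [coeff_substStar_mul hF c H le_rfl, coeff_mul_substStar hF' c H le_rfl]
  have : ∀ j, F ^ j * H = H * F' ^ j := by
    intro j
    induction j with
    | zero => simp
    | succ j ih => rw [pow_succ, mul_assoc, h, ← mul_assoc, ih, mul_assoc, ← pow_succ]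
  simp only [this]

theorem sum_range_sum_antidiagonal {A : Type*} [AddCommMonoid A] (N : ℕ) (g : ℕ → ℕ → A)
    (hg : ∀ j i, N ≤ j + i → g j i = 0) :
    ∑ m ∈ Finset.range N, ∑ p ∈ Finset.HasAntidiagonal.antidiagonal m, g p.1 p.2 =
      ∑ j ∈ Finset.range N, ∑ i ∈ Finset.range N, g j i := by
  rw [← Finset.sum_product', Finset.sum_sigma']
  refine Finset.sum_bij_ne_zero (fun x _ _ => x.2) ?_ ?_ ?_ ?_
  · rintro ⟨m, p⟩ h _
    simp only [Finset.mem_sigma, Finset.mem_range, Finset.HasAntidiagonal.mem_antidiagonal,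
      Finset.mem_product] at h ⊢
    omega
  · rintro ⟨m, p⟩ h _ ⟨m', p'⟩ h' _ hp
    simp only [Finset.mem_sigma, Finset.mem_range, Finset.HasAntidiagonal.mem_antidiagonal] at h h'
    simp only at hp
    subst hp
    obtain rfl : m = m' := by omega
    rfl
  · rintro p h h0
    refine ⟨⟨p.1 + p.2, p⟩, ?_, h0, rfl⟩
    simp only [Finset.mem_sigma, Finset.mem_range, Finset.HasAntidiagonal.mem_antidiagonal, and_true]
    by_contra hlt
    exact h0 (hg _ _ (by omega))
  · intros
    rfl

theorem substStar_mul_substStar {F : NSymHat} (hF : PowerSeries.constantCoeff F = 0)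
    (C D : PowerSeries ℚ) :
    substStar (fun j => PowerSeries.coeff j C) F * substStar (fun j => PowerSeries.coeff j D) F =
      substStar (fun j => PowerSeries.coeff j (C * D)) F := by
  ext1 n
  rw [coeff_substStar_mul hF _ _ le_rfl, coeff_substStar hF _ le_rfl]
  simp only [coeff_mul_substStar hF _ _ le_rfl, PowerSeries.coeff_mul, Finset.sum_smul,
    Finset.smul_sum, smul_smul, ← pow_add]
  rw [← sum_range_sum_antidiagonal (n + 1) fun j i =>
    (PowerSeries.coeff j C * PowerSeries.coeff i D) • PowerSeries.coeff n (F ^ (j + i))]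
  · refine Finset.sum_congr rfl fun m _ => Finset.sum_congr rfl fun p hp => ?_
    rw [Finset.HasAntidiagonal.mem_antidiagonal.1 hp]
  · intro j i h
    rw [coeff_pow_eq_zero hF (by omega), smul_zero]

theorem substStar_one {F : NSymHat} : substStar (fun j => PowerSeries.coeff j (1 : PowerSeries ℚ)) F = 1 := by
  ext1 n
  rw [substStar, PowerSeries.coeff_mk, Finset.sum_eq_single 0]
  · simp
  · intro j _ hj
    rw [PowerSeries.coeff_one, if_neg hj, zero_smul]
  · simp

theorem substStar_pow {F : NSymHat} (hF : PowerSeries.constantCoeff F = 0)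
    (C : PowerSeries ℚ) (k : ℕ) :
    substStar (fun j => PowerSeries.coeff j C) F ^ k =
      substStar (fun j => PowerSeries.coeff j (C ^ k)) F := by
  induction k with
  | zero => rw [pow_zero, pow_zero, substStar_one]
  | succ k ih => rw [pow_succ, ih, substStar_mul_substStar hF, ← pow_succ]

theorem constantCoeff_substStar (c : ℕ → ℚ) (F : NSymHat) :
    PowerSeries.constantCoeff (substStar c F) = c 0 • 1 := by
  rw [← PowerSeries.coeff_zero_eq_constantCoeff_apply, substStar, PowerSeries.coeff_mk]
  simp

/-- The powers of a single `F` commute, so identities between one-variable series over `ℚ` carry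
over to the noncommutative setting. -/
theorem substStar_substStar {F : NSymHat} (hF : PowerSeries.constantCoeff F = 0)
    (C : PowerSeries ℚ) {D : PowerSeries ℚ} (hD : PowerSeries.constantCoeff D = 0) :
    substStar (fun j => PowerSeries.coeff j C) (substStar (fun j => PowerSeries.coeff j D) F) =
      substStar (fun j => PowerSeries.coeff j (C.subst D)) F := by
  have h0 : PowerSeries.constantCoeff (substStar (fun j => PowerSeries.coeff j D) F) = 0 := by
    rw [constantCoeff_substStar, PowerSeries.coeff_zero_eq_constantCoeff_apply, hD, zero_smul]
  ext1 n
  rw [coeff_substStar h0 _ le_rfl, coeff_substStar hF _ le_rfl]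
  simp only [substStar_pow hF, coeff_substStar hF _ le_rfl, Finset.smul_sum, smul_smul]
  rw [Finset.sum_comm]
  refine Finset.sum_congr rfl fun m hm => ?_
  rw [← Finset.sum_smul]
  congr 1
  rw [Finset.mem_range] at hm
  rw [PowerSeries.coeff_subst' (PowerSeries.HasSubst.of_constantCoeff_zero' hD)]
  refine (finsum_eq_sum_of_support_subset _ fun j hj => ?_).symm
  rw [Finset.coe_range, Set.mem_Iio]
  by_contra hlt
  refine hj ?_
  simp only
  rw [coeff_pow_eq_zero hD (by omega), mul_zero]

/-- The composite satisfies `(1 + X) f' = f` with `f(0) = 1`. The resulting recursion gives `1` in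
degree one and then `0` from degree two on. -/
theorem exp_subst_log : (PowerSeries.exp ℚ).subst (PowerSeries.log ℚ) = 1 + PowerSeries.X := by
  set f := (PowerSeries.exp ℚ).subst (PowerSeries.log ℚ) with hf
  have hd : (1 + PowerSeries.X) * PowerSeries.derivative ℚ f = f := by
    rw [hf, PowerSeries.derivative_subst PowerSeries.HasSubst.log, PowerSeries.derivative_exp]
    have : (1 + PowerSeries.X) * PowerSeries.derivative ℚ (PowerSeries.log ℚ) = 1 := by
      rw [PowerSeries.deriv_log]
      ext n
      cases n with
      | zero => simp
      | succ n =>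
        rw [add_mul, one_mul, map_add, PowerSeries.coeff_succ_X_mul, PowerSeries.coeff_one]
        simp [pow_succ]
    rw [mul_left_comm, this, mul_one]
  have h0 : PowerSeries.coeff 0 f = 1 := by
    rw [hf, PowerSeries.coeff_subst' PowerSeries.HasSubst.log, finsum_eq_single _ 0]
    · simp
    · intro j hj
      rw [coeff_pow_eq_zero PowerSeries.constantCoeff_log (by omega), smul_zero]
  have hr : ∀ n, PowerSeries.coeff (n + 2) f * (n + 2) + PowerSeries.coeff (n + 1) f * (n + 1) =
      PowerSeries.coeff (n + 1) f := by
    intro n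
    have := congrArg (PowerSeries.coeff (n + 1)) hd
    rw [add_mul, one_mul, map_add, PowerSeries.coeff_succ_X_mul, PowerSeries.coeff_derivative,
      PowerSeries.coeff_derivative] at this
    push_cast at this
    linarith
  have h1 : PowerSeries.coeff 1 f = 1 := by
    have := congrArg (PowerSeries.coeff 0) hd
    rw [add_mul, one_mul, map_add, PowerSeries.coeff_zero_X_mul, PowerSeries.coeff_derivative, h0] at this
    simpa using this
  have h2 : ∀ n, PowerSeries.coeff (n + 2) f = 0 := by
    intro n
    induction n with
    | zero =>
      have := hr 0
      rw [zero_add, h1] at this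
      push_cast at this
      linarith
    | succ n ih =>
      have := hr (n + 1)
      rw [show n + 1 + 1 = n + 2 from rfl, ih, zero_mul, add_zero] at this
      rcases mul_eq_zero.1 this with h | h
      · exact h
      · push_cast at h
        linarith [(Nat.cast_nonneg n : (0 : ℚ) ≤ n)]
  ext n
  match n with
  | 0 => rw [h0]; simp
  | 1 => rw [h1]; simp [PowerSeries.coeff_one]
  | n + 2 => rw [h2]; simp [PowerSeries.coeff_one, PowerSeries.coeff_X]

/-! ### Logarithms and powers -/

theorem logStar_eq (G : NSymHat) :
    logStar G = substStar (fun j => PowerSeries.coeff j (PowerSeries.log ℚ)) (G - 1) := by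
  unfold logStar
  congr 1
  funext j
  rw [PowerSeries.coeff_log]
  split_ifs with h
  · simp [h]
  · rfl

theorem constantCoeff_logStar (G : NSymHat) : PowerSeries.constantCoeff (logStar G) = 0 := by
  rw [logStar, constantCoeff_substStar]
  simp

theorem powStar_eq (G : NSymHat) (a : ℚ) : powStar G a =
    substStar (fun j => PowerSeries.coeff j (PowerSeries.rescale a (PowerSeries.exp ℚ))) (logStar G) := by
  ext1 n
  simp only [powStar, expStar, substStar, PowerSeries.coeff_mk]
  refine Finset.sum_congr rfl fun j _ => ?_
  rw [smul_pow, PowerSeries.coeff_rescale, PowerSeries.coeff_exp, PowerSeries.coeff_smul, smul_smul,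
    mul_comm]
  rfl

theorem powStar_add (G : NSymHat) (a b : ℚ) : powStar G (a + b) = powStar G a * powStar G b := by
  rw [powStar_eq, powStar_eq, powStar_eq, substStar_mul_substStar (constantCoeff_logStar G),
    PowerSeries.exp_mul_exp_eq_exp_add]

theorem powStar_one {G : NSymHat} (hG : PowerSeries.constantCoeff G = 1) : powStar G 1 = G := by
  have h0 : PowerSeries.constantCoeff (G - 1) = 0 := by rw [map_sub, hG, map_one, sub_self]
  rw [powStar_eq, PowerSeries.rescale_one, RingHom.id_apply, logStar_eq,
    substStar_substStar h0 _ PowerSeries.constantCoeff_log, exp_subst_log]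
  ext1 n
  rw [coeff_substStar h0 _ (Nat.le_succ n), Finset.sum_range_succ', Finset.sum_range_succ']
  simp [PowerSeries.coeff_one, PowerSeries.coeff_X]

theorem powStar_zero (G : NSymHat) : powStar G 0 = 1 := by
  rw [powStar_eq]
  convert substStar_one (F := logStar G) using 4
  ext n
  rw [PowerSeries.coeff_rescale, PowerSeries.coeff_one]
  split_ifs with h
  · simp [h]
  · simp [h]

theorem powStar_natCast {G : NSymHat} (hG : PowerSeries.constantCoeff G = 1) (k : ℕ) :
    powStar G k = G ^ k := by
  induction k with
  | zero => rw [Nat.cast_zero, powStar_zero, pow_zero]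
  | succ k ih => rw [Nat.cast_succ, powStar_add, ih, powStar_one hG, pow_succ]

theorem powStar_mul_eq {G G' H : NSymHat} (hG : PowerSeries.constantCoeff G = 1)
    (hG' : PowerSeries.constantCoeff G' = 1) (h : G * H = H * G') (a : ℚ) :
    powStar G a * H = H * powStar G' a := by
  rw [powStar_eq, powStar_eq]
  refine substStar_mul_eq (constantCoeff_logStar _) (constantCoeff_logStar _) ?_ _
  refine substStar_mul_eq ?_ ?_ ?_ _
  · rw [map_sub, hG, map_one, sub_self]
  · rw [map_sub, hG', map_one, sub_self]
  · rw [sub_mul, mul_sub, h, one_mul, mul_one]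

/-- The divided power `(½ log_⋆ G)^k / k!`. -/
noncomputable def dividedLog (G : NSymHat) (k : ℕ) : NSymHat :=
  (1 / (k.factorial : ℚ)) • ((1 / 2 : ℚ) • logStar G) ^ k

theorem coeff_mul_dividedLog_eq_zero (G H : NSymHat) {n k : ℕ} (h : n < k) :
    PowerSeries.coeff n (H * dividedLog G k) = 0 := by
  rw [dividedLog, smul_pow, mul_smul_comm, mul_smul_comm, PowerSeries.coeff_smul,
    PowerSeries.coeff_smul, coeff_mul_pow_eq_zero (constantCoeff_logStar G) h, smul_zero, smul_zero]

/-- This is the source of the polynomials in `x`: in degree `n` the exponential series for `G^(x/2)`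
stops at `xⁿ`, since the logarithm has no constant term. -/
theorem coeff_mul_powStar (G H : NSymHat) (x : ℚ) (n : ℕ) :
    PowerSeries.coeff n (H * powStar G (x / 2)) =
      ∑ k ∈ Finset.range (n + 1), x ^ k • PowerSeries.coeff n (H * dividedLog G k) := by
  rw [powStar_eq, coeff_mul_substStar (constantCoeff_logStar G) _ _ le_rfl]
  refine Finset.sum_congr rfl fun k _ => ?_
  rw [dividedLog, smul_pow, mul_smul_comm, mul_smul_comm, PowerSeries.coeff_smul,
    PowerSeries.coeff_smul, smul_smul, smul_smul, PowerSeries.coeff_rescale, PowerSeries.coeff_exp]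
  congr 1
  simp only [eq_ratCast, Rat.cast_id, div_pow, one_pow]
  ring

/-! ### Vanishing of polynomials with vector coefficients -/

/-- Every linear functional turns the sum into a polynomial over `ℚ` with infinitely many roots. -/
theorem eq_zero_of_sum_pow_smul_eq_zero {V : Type*} [AddCommGroup V] [Module ℚ V] {N : ℕ}
    {v : ℕ → V} {s : Set ℕ} (hs : s.Infinite)
    (h : ∀ x ∈ s, ∑ k ∈ Finset.range N, (x : ℚ) ^ k • v k = 0) {k : ℕ} (hk : k < N) : v k = 0 := by
  rw [← Module.forall_dual_apply_eq_zero_iff ℚ]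
  intro φ
  set p : Polynomial ℚ := ∑ k ∈ Finset.range N, Polynomial.monomial k (φ (v k)) with hp
  have hp0 : p = 0 := by
    refine Polynomial.eq_zero_of_infinite_isRoot p
      ((hs.image Nat.cast_injective.injOn).mono (t := {x : ℚ | p.IsRoot x}) ?_)
    rintro _ ⟨x, hx, rfl⟩
    have := congrArg φ (h x hx)
    rw [map_sum, map_zero] at this
    simp only [map_smul, smul_eq_mul] at this
    rw [Set.mem_ofPred_eq, Polynomial.IsRoot.def, hp, Polynomial.eval_finsetSum, ← this]
    refine Finset.sum_congr rfl fun k _ => ?_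
    rw [Polynomial.eval_monomial, mul_comm]
  have := congrArg (fun q => Polynomial.coeff q k) hp0
  simpa [hp, Polynomial.finsetSum_coeff, Polynomial.coeff_monomial, hk] using this

theorem mem_of_sum_pow_smul_mem {V : Type*} [AddCommGroup V] [Module ℚ V] (W : Submodule ℚ V)
    {N : ℕ} {v : ℕ → V} {s : Set ℕ} (hs : s.Infinite)
    (h : ∀ x ∈ s, ∑ k ∈ Finset.range N, (x : ℚ) ^ k • v k ∈ W) {k : ℕ} (hk : k < N) : v k ∈ W := by
  rw [← Submodule.Quotient.mk_eq_zero]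
  refine eq_zero_of_sum_pow_smul_eq_zero (v := fun k => Submodule.Quotient.mk (p := W) (v k)) hs
    (fun x hx => ?_) hk
  have := (Submodule.Quotient.mk_eq_zero W).2 (h x hx)
  rw [← this, ← Submodule.mkQ_apply, map_sum]
  rfl

theorem infinite_setOf_odd_iff (p : Prop) : {x : ℕ | Odd x ↔ p}.Infinite := by
  by_cases hp : p
  · refine Set.infinite_of_injective_forall_mem (f := fun k : ℕ => 2 * k + 1)
      (fun a b h => by simpa using h) fun k => ?_
    simp [hp]
  · refine Set.infinite_of_injective_forall_mem (f := fun k : ℕ => 2 * k)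
      (fun a b h => by simpa using h) fun k => ?_
    simp [hp]

theorem neg_one_pow_smul {R : Type*} [Ring R] [Module ℚ R] (n : ℕ) (v : R) :
    (-1 : ℚ) ^ n • v = (-1) ^ n * v := by
  rcases Nat.even_or_odd n with h | h
  · rw [h.neg_one_pow, h.neg_one_pow, one_mul, one_smul]
  · rw [h.neg_one_pow, h.neg_one_pow, neg_one_mul, neg_one_smul]

/-- A polynomial `P` with `(-1)ⁿ P(x) = P(-x)` has only terms of the parity of `n`. -/
theorem eq_zero_of_sum_neg_pow_smul {V : Type*} [AddCommGroup V] [Module ℚ V] {n : ℕ}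
    {v : ℕ → V} {s : Set ℕ} (hs : s.Infinite)
    (h : ∀ x ∈ s, (-1 : ℚ) ^ n • ∑ k ∈ Finset.range (n + 1), (x : ℚ) ^ k • v k =
      ∑ k ∈ Finset.range (n + 1), (-(x : ℚ)) ^ k • v k) {k : ℕ} (hkn : k < n + 1)
    (hk : ¬ k ≡ n [MOD 2]) : v k = 0 := by
  have key : ((-1 : ℚ) ^ n - (-1) ^ k) • v k = 0 := by
    refine eq_zero_of_sum_pow_smul_eq_zero (N := n + 1)
      (v := fun k => ((-1 : ℚ) ^ n - (-1) ^ k) • v k) hs (fun x hx => ?_) hkn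
    rw [← sub_eq_zero.2 (h x hx), Finset.smul_sum, ← Finset.sum_sub_distrib]
    refine Finset.sum_congr rfl fun j _ => ?_
    rw [smul_smul, smul_smul, ← sub_smul, neg_pow (x : ℚ) j]
    congr 1
    ring
  refine (smul_eq_zero.1 key).resolve_left fun h => hk ?_
  rcases Nat.even_or_odd n with hn | hn <;> rcases Nat.even_or_odd k with hk' | hk'
  · exact (Nat.even_iff.1 hk').trans (Nat.even_iff.1 hn).symm
  · rw [hn.neg_one_pow, hk'.neg_one_pow] at h; norm_num at h
  · rw [hn.neg_one_pow, hk'.neg_one_pow] at h; norm_num at h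
  · exact (Nat.odd_iff.1 hk').trans (Nat.odd_iff.1 hn).symm

/-! ### The coefficients of the alternating products -/

/-- The coefficients of `(A ⋆ B)^(x/2)` as a polynomial in `x`. -/
noncomputable def evenCoeff (A B : NSymHat) (k : ℕ) : NSymHat := dividedLog (A * B) k

/-- The coefficients of `A ⋆ (B ⋆ A)^((x-1)/2)` as a polynomial in `x`. -/
noncomputable def oddCoeff (A B : NSymHat) (k : ℕ) : NSymHat :=
  A * powStar (B * A) (-1 / 2) * dividedLog (B * A) k

theorem constantCoeff_mul_eq_one {A B : NSymHat} (hA : PowerSeries.constantCoeff A = 1)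
    (hB : PowerSeries.constantCoeff B = 1) :
    PowerSeries.constantCoeff (A * B) = 1 := by
  rw [map_mul, hA, hB, one_mul]

theorem coeff_mul_pow {A B : NSymHat} (hA : PowerSeries.constantCoeff A = 1)
    (hB : PowerSeries.constantCoeff B = 1) (k n : ℕ) :
    PowerSeries.coeff n ((A * B) ^ k) =
    ∑ j ∈ Finset.range (n + 1), ((2 * k : ℕ) : ℚ) ^ j • PowerSeries.coeff n (evenCoeff A B j) := by
  have h := coeff_mul_powStar (A * B) 1 ((2 * k : ℕ) : ℚ) n
  rw [show ((2 * k : ℕ) : ℚ) / 2 = k by push_cast; ring,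
    powStar_natCast (constantCoeff_mul_eq_one hA hB)] at h
  simpa only [one_mul, evenCoeff] using h

theorem coeff_mul_mul_pow {A B : NSymHat} (hA : PowerSeries.constantCoeff A = 1)
    (hB : PowerSeries.constantCoeff B = 1) (k n : ℕ) :
    PowerSeries.coeff n (A * (B * A) ^ k) =
    ∑ j ∈ Finset.range (n + 1), ((2 * k + 1 : ℕ) : ℚ) ^ j • PowerSeries.coeff n (oddCoeff A B j) := by
  have h := coeff_mul_powStar (B * A) (A * powStar (B * A) (-1 / 2)) ((2 * k + 1 : ℕ) : ℚ) n
  rwa [mul_assoc, ← powStar_add, show (-1 / 2 : ℚ) + ((2 * k + 1 : ℕ) : ℚ) / 2 = k by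
    push_cast; ring, powStar_natCast (constantCoeff_mul_eq_one hB hA)] at h

/-- Since `A(-X) = B⁻¹` and `B(-X) = A⁻¹`, the sign change inverts `A ⋆ B`. On the polynomials it
therefore amounts to `x ↦ -x`, which gives the parity vanishing. -/
theorem negX_mul_pow {A B : NSymHat} (hA : PowerSeries.constantCoeff A = 1)
    (hB : PowerSeries.constantCoeff B = 1)
    (h1 : negX NSym A * B = 1) (h2 : negX NSym B * A = 1) (k : ℕ) :
    negX NSym ((A * B) ^ k) = powStar (A * B) (-k) := by
  have h3 : negX NSym (A * B) * (A * B) = 1 := by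
    rw [map_mul, mul_assoc, ← mul_assoc _ A B, h2, one_mul, h1]
  have h4 : (A * B) * negX NSym (A * B) = 1 := by
    refine mul_eq_one_of_constantCoeff ?_ h3
    rw [← PowerSeries.coeff_zero_eq_constantCoeff_apply, coeff_negX, pow_zero, one_mul,
      PowerSeries.coeff_zero_eq_constantCoeff_apply, constantCoeff_mul_eq_one hA hB]
  have h5 : (A * B) ^ k * negX NSym (A * B) ^ k = 1 := by
    rw [← (show Commute (A * B) (negX NSym (A * B)) from h4.trans h3.symm).mul_pow, h4, one_pow]
  rw [map_pow]
  refine (left_inv_eq_right_inv ?_ h5).symm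
  rw [← powStar_natCast (constantCoeff_mul_eq_one hA hB), ← powStar_add, neg_add_cancel, powStar_zero]

theorem coeff_evenCoeff_eq_zero {A B : NSymHat} (hA : PowerSeries.constantCoeff A = 1)
    (hB : PowerSeries.constantCoeff B = 1)
    (h1 : negX NSym A * B = 1) (h2 : negX NSym B * A = 1) {n k : ℕ}
    (hk : ¬ k ≡ n [MOD 2]) : PowerSeries.coeff n (evenCoeff A B k) = 0 := by
  rcases lt_or_ge n k with hnk | hnk
  · simpa [evenCoeff] using coeff_mul_dividedLog_eq_zero (A * B) 1 hnk
  refine eq_zero_of_sum_neg_pow_smul (infinite_setOf_odd_iff False) (fun x hx => ?_)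
    (v := fun k => PowerSeries.coeff n (evenCoeff A B k)) (Nat.lt_succ_of_le hnk) hk
  obtain ⟨m, rfl⟩ : ∃ m, x = 2 * m := by
    rw [Set.mem_ofPred_eq, iff_false, Nat.not_odd_iff_even] at hx
    exact hx.exists_two_nsmul.imp fun m hm => by simpa using hm
  have h3 := congrArg (PowerSeries.coeff n) (negX_mul_pow hA hB h1 h2 m)
  have h4 := coeff_mul_powStar (A * B) 1 (-((2 * m : ℕ) : ℚ)) n
  rw [show -((2 * m : ℕ) : ℚ) / 2 = -m by push_cast; ring] at h4
  simp only [one_mul] at h4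
  rw [h4, coeff_negX, coeff_mul_pow hA hB] at h3
  exact (neg_one_pow_smul _ _).trans h3

theorem negX_mul_mul_pow {A B : NSymHat} (hA : PowerSeries.constantCoeff A = 1)
    (hB : PowerSeries.constantCoeff B = 1)
    (h1 : negX NSym A * B = 1) (h2 : negX NSym B * A = 1) (k : ℕ) :
    negX NSym (A * (B * A) ^ k) = A * powStar (B * A) (-1 - k) := by
  rw [map_mul, negX_mul_pow hB hA h2 h1, sub_eq_add_neg, powStar_add, ← mul_assoc]
  congr 1
  have h3 : negX NSym A * (B * A) = A := by rw [← mul_assoc, h1, one_mul]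
  have h4 : B * A * powStar (B * A) (-1) = 1 := by
    have := powStar_add (B * A) 1 (-1)
    rw [add_neg_cancel, powStar_zero, powStar_one (constantCoeff_mul_eq_one hB hA)] at this
    exact this.symm
  calc negX NSym A = negX NSym A * (B * A * powStar (B * A) (-1)) := by rw [h4, mul_one]
    _ = A * powStar (B * A) (-1) := by rw [← mul_assoc, h3]

theorem coeff_oddCoeff_eq_zero {A B : NSymHat} (hA : PowerSeries.constantCoeff A = 1)
    (hB : PowerSeries.constantCoeff B = 1)
    (h1 : negX NSym A * B = 1) (h2 : negX NSym B * A = 1) {n k : ℕ}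
    (hk : ¬ k ≡ n [MOD 2]) : PowerSeries.coeff n (oddCoeff A B k) = 0 := by
  rcases lt_or_ge n k with hnk | hnk
  · exact coeff_mul_dividedLog_eq_zero _ _ hnk
  refine eq_zero_of_sum_neg_pow_smul (infinite_setOf_odd_iff True) (fun x hx => ?_)
    (v := fun k => PowerSeries.coeff n (oddCoeff A B k)) (Nat.lt_succ_of_le hnk) hk
  obtain ⟨m, rfl⟩ : ∃ m, x = 2 * m + 1 := by
    rw [Set.mem_ofPred_eq, iff_true] at hx
    exact hx
  have h3 := congrArg (PowerSeries.coeff n) (negX_mul_mul_pow hA hB h1 h2 m)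
  have h4 := coeff_mul_powStar (B * A) (A * powStar (B * A) (-1 / 2)) (-((2 * m + 1 : ℕ) : ℚ)) n
  rw [mul_assoc, ← powStar_add,
    show (-1 / 2 : ℚ) + -((2 * m + 1 : ℕ) : ℚ) / 2 = -1 - m by push_cast; ring] at h4
  rw [h4, coeff_negX, coeff_mul_mul_pow hA hB] at h3
  exact (neg_one_pow_smul _ _).trans h3

/-! ### Leading coefficients -/

theorem coeff_pow_self {R : Type*} [Ring R] {F : PowerSeries R}
    (hF : PowerSeries.constantCoeff F = 0) (n : ℕ) :
    PowerSeries.coeff n (F ^ n) = PowerSeries.coeff 1 F ^ n := by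
  induction n with
  | zero => simp
  | succ n ih =>
    rw [pow_succ, PowerSeries.coeff_mul, Finset.sum_eq_single (n, 1), ih, pow_succ]
    · rintro ⟨a, b⟩ hp hab
      rw [Finset.HasAntidiagonal.mem_antidiagonal] at hp
      simp only at hp
      rcases Nat.eq_zero_or_pos b with rfl | hb
      · rw [PowerSeries.coeff_zero_eq_constantCoeff_apply, hF, mul_zero]
      · rw [coeff_pow_eq_zero hF, zero_mul]
        by_contra h
        exact hab (Prod.ext (by simp only; omega) (by simp only; omega))
    · intro h
      exact absurd (Finset.HasAntidiagonal.mem_antidiagonal.2 (rfl : n + 1 = n + 1)) h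

theorem coeff_dividedLog_eq_zero (G : NSymHat) {n k : ℕ} (h : n < k) :
    PowerSeries.coeff n (dividedLog G k) = 0 := by
  simpa using coeff_mul_dividedLog_eq_zero G 1 h

theorem coeff_one_logStar (G : NSymHat) :
    PowerSeries.coeff 1 (logStar G) = PowerSeries.coeff 1 G := by
  rw [logStar, substStar, PowerSeries.coeff_mk, Finset.sum_range_succ, Finset.sum_range_one]
  simp [PowerSeries.coeff_one]

theorem coeff_dividedLog_self (G : NSymHat) (n : ℕ) : PowerSeries.coeff n (dividedLog G n) =
    (1 / (n.factorial : ℚ)) • ((1 / 2 : ℚ) • PowerSeries.coeff 1 G) ^ n := by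
  rw [dividedLog, PowerSeries.coeff_smul, coeff_pow_self, PowerSeries.coeff_smul,
    coeff_one_logStar]
  rw [PowerSeries.constantCoeff_smul, constantCoeff_logStar, smul_zero]

theorem coeff_mul_dividedLog_self (G H : NSymHat) (n : ℕ) :
    PowerSeries.coeff n (H * dividedLog G n) =
      PowerSeries.coeff 0 H * PowerSeries.coeff n (dividedLog G n) := by
  rw [PowerSeries.coeff_mul, Finset.sum_eq_single (0, n)]
  · rintro ⟨a, b⟩ hp hab
    rw [Finset.HasAntidiagonal.mem_antidiagonal] at hp
    simp only at hp
    rw [coeff_dividedLog_eq_zero, mul_zero]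
    by_contra h
    exact hab (Prod.ext (by simp only; omega) (by simp only; omega))
  · intro h
    exact absurd (Finset.HasAntidiagonal.mem_antidiagonal.2 (zero_add n)) h

theorem coeff_mul_dividedLog_add_two (G : NSymHat) {H : NSymHat} (h0 : PowerSeries.coeff 0 H = 1)
    (h1 : PowerSeries.coeff 1 H = 0) (n : ℕ) :
    PowerSeries.coeff (n + 2) (H * dividedLog G n) =
      PowerSeries.coeff (n + 2) (dividedLog G n) +
        PowerSeries.coeff 2 H * PowerSeries.coeff n (dividedLog G n) := by
  rw [PowerSeries.coeff_mul, Finset.Nat.sum_antidiagonal_succ, Finset.Nat.sum_antidiagonal_succ,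
    h0, h1, one_mul, zero_mul, zero_add, Finset.sum_eq_single (0, n)]
  · rintro ⟨a, b⟩ hp hab
    rw [Finset.HasAntidiagonal.mem_antidiagonal] at hp
    simp only at hp
    rw [coeff_dividedLog_eq_zero, mul_zero]
    by_contra h
    exact hab (Prod.ext (by simp only; omega) (by simp only; omega))
  · intro h
    exact absurd (Finset.HasAntidiagonal.mem_antidiagonal.2 (zero_add n)) h

theorem coeff_one_mul {R : Type*} [Ring R] (F G : PowerSeries R) : PowerSeries.coeff 1 (F * G) =
    PowerSeries.coeff 0 F * PowerSeries.coeff 1 G + PowerSeries.coeff 1 F * PowerSeries.coeff 0 G := by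
  rw [PowerSeries.coeff_mul, Finset.Nat.sum_antidiagonal_succ]
  simp

theorem constantCoeff_powStar (G : NSymHat) (a : ℚ) : PowerSeries.constantCoeff (powStar G a) = 1 := by
  rw [powStar_eq, constantCoeff_substStar]
  simp

theorem dividedLog_zero (G : NSymHat) : dividedLog G 0 = 1 := by
  simp [dividedLog]

/-- In degree `n` the `n`-th power of the logarithm sees only its degree `1` part, which is the sum
of those of `A` and `B`. -/
theorem coeff_evenCoeff_self_comm {A B : NSymHat} (hA : PowerSeries.constantCoeff A = 1)
    (hB : PowerSeries.constantCoeff B = 1) (n : ℕ) :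
    PowerSeries.coeff n (evenCoeff A B n) = PowerSeries.coeff n (evenCoeff B A n) := by
  rw [evenCoeff, evenCoeff, coeff_dividedLog_self, coeff_dividedLog_self, coeff_one_mul,
    coeff_one_mul]
  simp only [PowerSeries.coeff_zero_eq_constantCoeff_apply, hA, hB, one_mul, mul_one]
  rw [add_comm]

theorem coeff_oddCoeff_self {A B : NSymHat} (hA : PowerSeries.constantCoeff A = 1) (n : ℕ) :
    PowerSeries.coeff n (oddCoeff A B n) = PowerSeries.coeff n (evenCoeff B A n) := by
  rw [oddCoeff, coeff_mul_dividedLog_self, PowerSeries.coeff_zero_eq_constantCoeff_apply, map_mul,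
    hA, constantCoeff_powStar, one_mul, one_mul, evenCoeff]

/-- Put `U = A ⋆ (B ⋆ A)^(-1/2)` and `U' = B ⋆ (A ⋆ B)^(-1/2)`. Then `U ⋆ U' = 1` and neither has a
term of degree `1`, so their terms of degree `2` are opposite. In the sum of the two odd
coefficients these multiply the same leading coefficient and cancel. -/
theorem coeff_oddCoeff_add_two {A B : NSymHat} (hA : PowerSeries.constantCoeff A = 1)
    (hB : PowerSeries.constantCoeff B = 1)
    (h1 : negX NSym A * B = 1) (h2 : negX NSym B * A = 1) (n : ℕ) :
    PowerSeries.coeff (n + 2) (oddCoeff A B n) + PowerSeries.coeff (n + 2) (oddCoeff B A n) =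
      PowerSeries.coeff (n + 2) (evenCoeff A B n) + PowerSeries.coeff (n + 2) (evenCoeff B A n) := by
  have hU0 : ∀ {A B : NSymHat}, PowerSeries.constantCoeff A = 1 →
      PowerSeries.coeff 0 (A * powStar (B * A) (-1 / 2)) = 1 := by
    intro A B hA
    rw [PowerSeries.coeff_zero_eq_constantCoeff_apply, map_mul, hA, constantCoeff_powStar, one_mul]
  have hU1 : ∀ {A B : NSymHat}, PowerSeries.constantCoeff A = 1 → PowerSeries.constantCoeff B = 1 →
      negX NSym A * B = 1 → negX NSym B * A = 1 →
      PowerSeries.coeff 1 (A * powStar (B * A) (-1 / 2)) = 0 := by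
    intro A B hA hB h1 h2
    -- The series is itself the odd coefficient with `k = 0`, whose degree `1` part has the wrong
    -- parity.
    have := coeff_oddCoeff_eq_zero hA hB h1 h2 (n := 1) (k := 0) (by decide)
    rwa [oddCoeff, dividedLog_zero, mul_one] at this
  have hUU : A * powStar (B * A) (-1 / 2) * (B * powStar (A * B) (-1 / 2)) = 1 := by
    rw [mul_assoc, ← mul_assoc _ B, powStar_mul_eq (constantCoeff_mul_eq_one hB hA)
      (constantCoeff_mul_eq_one hA hB) (mul_assoc B A B), mul_assoc, ← powStar_add, ← mul_assoc]
    have := powStar_add (A * B) 1 (-1)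
    rw [add_neg_cancel, powStar_zero, powStar_one (constantCoeff_mul_eq_one hA hB)] at this
    rw [this]
    norm_num
  have hU2 := congrArg (PowerSeries.coeff 2) hUU
  rw [PowerSeries.coeff_mul, Finset.Nat.sum_antidiagonal_succ, Finset.Nat.sum_antidiagonal_succ,
    hU0 hA, hU1 hA hB h1 h2, zero_mul, one_mul, zero_add, Finset.Nat.antidiagonal_zero,
    Finset.sum_singleton, hU0 hB, mul_one, PowerSeries.coeff_one, if_neg two_ne_zero] at hU2
  have hc := coeff_evenCoeff_self_comm hA hB n
  unfold evenCoeff at hc ⊢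
  unfold oddCoeff
  rw [coeff_mul_dividedLog_add_two _ (hU0 hA) (hU1 hA hB h1 h2),
    coeff_mul_dividedLog_add_two _ (hU0 hB) (hU1 hB hA h2 h1), hc,
    add_add_add_comm, ← add_mul, add_comm (PowerSeries.coeff 2 _)]
  simp only [zero_add] at hU2
  rw [hU2, zero_mul, add_zero, add_comm]

/-! ### The coefficients in the group algebra -/

/-- `V₁⁺` for even `s` and `V₁⁻` for odd `s`. -/
noncomputable def altLetter (s : ℕ) : NSymHat := if Even s then V1plus else V1minus

theorem constantCoeff_altLetter (s : ℕ) : PowerSeries.constantCoeff (altLetter s) = 1 := by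
  unfold altLetter
  split_ifs
  · exact constantCoeff_V1plus
  · exact constantCoeff_V1minus

theorem altLetter_congr {s t : ℕ} (h : Even (s + t)) : altLetter s = altLetter t := by
  unfold altLetter
  rw [Nat.even_add] at h
  simp only [h]

theorem negX_altLetter_mul (s : ℕ) : negX NSym (altLetter s) * altLetter (s + 1) = 1 := by
  unfold altLetter
  by_cases h : Even s
  · simp only [h, Nat.even_add_one, not_true, if_true, if_false, negX_V1plus_mul_V1minus]
  · simp only [h, Nat.even_add_one, not_false_eq_true, if_true, if_false, negX_V1minus_mul_V1plus]

theorem negX_altLetter_succ_mul (s : ℕ) : negX NSym (altLetter (s + 1)) * altLetter s = 1 := by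
  rw [altLetter_congr (s := s) (t := s + 1 + 1) ⟨s + 1, by ring⟩]
  exact negX_altLetter_mul _

theorem altSeries_succ (s k : ℕ) : altSeries s (k + 1) = altSeries s k * altLetter (s + k) := rfl

theorem altSeries_two_mul (s k : ℕ) :
    altSeries s (2 * k) = (altLetter s * altLetter (s + 1)) ^ k := by
  induction k with
  | zero => rfl
  | succ k ih =>
    rw [show 2 * (k + 1) = 2 * k + 1 + 1 by ring, altSeries_succ, altSeries_succ, ih, mul_assoc, pow_succ,
      altLetter_congr (s := s + 2 * k) (t := s) ⟨s + k, by ring⟩,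
      altLetter_congr (s := s + (2 * k + 1)) (t := s + 1) ⟨s + k + 1, by ring⟩]

theorem altSeries_two_mul_add_one (s k : ℕ) :
    altSeries s (2 * k + 1) = altLetter s * (altLetter (s + 1) * altLetter s) ^ k := by
  rw [altSeries_succ, altSeries_two_mul, altLetter_congr (s := s + 2 * k) (t := s) ⟨s + k, by ring⟩]
  induction k with
  | zero => simp
  | succ k ih => rw [pow_succ', mul_assoc, ih, pow_succ']; simp only [mul_assoc]

/-- The coefficients of the polynomials in `x` that give the alternating products of `x` factors, for
`x` of a given parity. -/
noncomputable def altCoeff (x s k : ℕ) : NSymHat :=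
  if Even x then evenCoeff (altLetter s) (altLetter (s + 1)) k
  else oddCoeff (altLetter s) (altLetter (s + 1)) k

theorem altCoeff_congr {x y s t : ℕ} (h : Even (x + y)) (h' : Even (s + t)) (k : ℕ) :
    altCoeff x s k = altCoeff y t k := by
  unfold altCoeff
  rw [Nat.even_add] at h
  rw [altLetter_congr h', altLetter_congr (s := s + 1) (t := t + 1) (by
    rw [show s + 1 + (t + 1) = s + t + 2 by ring]; exact h'.add even_two)]
  simp only [h]

theorem coeff_altSeries (s x n : ℕ) : PowerSeries.coeff n (altSeries s x) =
    ∑ j ∈ Finset.range (n + 1), (x : ℚ) ^ j • PowerSeries.coeff n (altCoeff x s j) := by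
  have hA := constantCoeff_altLetter s
  have hB := constantCoeff_altLetter (s + 1)
  rcases Nat.even_or_odd' x with ⟨k, rfl | rfl⟩
  · rw [altSeries_two_mul, coeff_mul_pow hA hB]
    simp only [altCoeff, even_two_mul, if_true]
  · rw [altSeries_two_mul_add_one, coeff_mul_mul_pow hA hB]
    simp only [altCoeff, Nat.even_add_one, even_two_mul, not_true, if_false]

theorem coeff_altCoeff_eq_zero (x s : ℕ) {n k : ℕ} (hk : ¬ k ≡ n [MOD 2]) :
    PowerSeries.coeff n (altCoeff x s k) = 0 := by
  unfold altCoeff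
  split_ifs
  · exact coeff_evenCoeff_eq_zero (constantCoeff_altLetter _) (constantCoeff_altLetter _)
      (negX_altLetter_mul s) (negX_altLetter_succ_mul s) hk
  · exact coeff_oddCoeff_eq_zero (constantCoeff_altLetter _) (constantCoeff_altLetter _)
      (negX_altLetter_mul s) (negX_altLetter_succ_mul s) hk

/-- The degree `n` part of the coefficients of the alternating products. -/
noncomputable def groupCoeff (n x s k : ℕ) : GroupAlg n := degreePart n (altCoeff x s k)

theorem groupCoeff_congr {n x y s t : ℕ} (h : Even (x + y)) (h' : Even (s + t)) (k : ℕ) :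
    groupCoeff n x s k = groupCoeff n y t k := by
  rw [groupCoeff, altCoeff_congr h h', groupCoeff]

theorem blockSum_eq_sum_groupCoeff {n : ℕ} (hn : 0 < n) (s x : ℕ) : blockSum n s x =
    ∑ j ∈ Finset.range (n + 1), (x : ℚ) ^ j • groupCoeff n x s j := by
  obtain ⟨n, rfl⟩ := Nat.exists_eq_add_of_lt hn
  rw [zero_add, ← degreePart_altSeries, degreePart, coeff_altSeries, map_sum]
  simp only [map_smul]
  rfl

/-- Compare the coefficients on the two sides of `blockSum_mul`. The symbols `(x, s)` modulo 2
compose like the affine maps `z ↦ s + x z`. -/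
theorem groupCoeff_mul {n : ℕ} (hn : 0 < n) (x y s t : ℕ) {i j : ℕ} (hi : i < n + 1) (hj : j < n + 1) :
    groupCoeff n x s i * groupCoeff n y t j =
      if i = j then groupCoeff n (x * y) (s + t * x) i else 0 := by
  rw [← sub_eq_zero]
  -- The block sums are polynomial in the number of blocks only within a parity class, so each
  -- variable runs over the numbers of a fixed parity.
  refine eq_zero_of_sum_pow_smul_eq_zero (s := {v : ℕ | Odd v ↔ Odd y}) (infinite_setOf_odd_iff _)
    (v := fun j => groupCoeff n x s i * groupCoeff n y t j -
      if i = j then groupCoeff n (x * y) (s + t * x) i else 0) (fun v hv => ?_) hj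
  refine eq_zero_of_sum_pow_smul_eq_zero (s := {u : ℕ | Odd u ↔ Odd x}) (infinite_setOf_odd_iff _)
    (v := fun i => ∑ j ∈ Finset.range (n + 1), (v : ℚ) ^ j • (groupCoeff n x s i * groupCoeff n y t j -
      if i = j then groupCoeff n (x * y) (s + t * x) i else 0)) (fun u hu => ?_) hi
  rw [Set.mem_ofPred_eq] at hu hv
  have hu' : Even (x + u) := by rw [Nat.even_add, ← Nat.not_odd_iff_even, ← Nat.not_odd_iff_even, hu]
  have hv' : Even (y + v) := by rw [Nat.even_add, ← Nat.not_odd_iff_even, ← Nat.not_odd_iff_even, hv]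
  have h := blockSum_mul n s t u v
  rw [blockSum_eq_sum_groupCoeff hn, blockSum_eq_sum_groupCoeff hn, blockSum_eq_sum_groupCoeff hn,
    Finset.sum_mul_sum, ← sub_eq_zero, ← Finset.sum_sub_distrib] at h
  refine Eq.trans ?_ h
  refine Finset.sum_congr rfl fun i hi => ?_
  have h1 : groupCoeff n (u * v) (s + t * u) i = groupCoeff n (x * y) (s + t * x) i := by
    refine groupCoeff_congr ?_ ?_ i
    · rw [Nat.even_add] at hu' hv' ⊢
      rw [Nat.even_mul, Nat.even_mul, hu', hv']
    · rw [Nat.even_add] at hu' ⊢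
      rw [Nat.even_add, Nat.even_add, Nat.even_mul, Nat.even_mul, hu']
  simp only [groupCoeff_congr (n := n) hu' (⟨s, rfl⟩ : Even (s + s)),
    groupCoeff_congr (n := n) hv' (⟨t, rfl⟩ : Even (t + t)), smul_sub, Finset.sum_sub_distrib,
    smul_ite, smul_zero, Finset.sum_ite_eq, if_pos hi, Finset.smul_sum, smul_mul_smul_comm, smul_smul,
    h1, Nat.cast_mul, mul_pow]

/-! ### The transfer operators only see the runs -/

theorem stepOp_of_match {s : ℕ} {u : Bool} {c : ℕ → ℚ} {b : ℕ} (h : u = true ↔ ¬ Even (s + b)) :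
    stepOp s u c b = (∑ a ∈ Finset.range b, c a) + c b := by
  rw [stepOp, if_pos h]

theorem stepOp_of_not_match {s : ℕ} {u : Bool} {c : ℕ → ℚ} {b : ℕ}
    (h : ¬ (u = true ↔ ¬ Even (s + b))) : stepOp s u c b = ∑ a ∈ Finset.range b, c a := by
  rw [stepOp, if_neg h, add_zero]

theorem match_succ {s : ℕ} {u : Bool} {b : ℕ} :
    (u = true ↔ ¬ Even (s + (b + 1))) ↔ ¬ (u = true ↔ ¬ Even (s + b)) := by
  rw [← add_assoc, Nat.even_add_one]
  tauto

theorem match_not {s : ℕ} {u : Bool} {b : ℕ} :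
    ((!u) = true ↔ ¬ Even (s + b)) ↔ ¬ (u = true ↔ ¬ Even (s + b)) := by
  cases u <;> simp

/-- A surplus step of one run can be moved across the turning point into the next run. This is why
the position of the turns does not matter, only their number. -/
theorem stepOp_stepOp_stepOp (s : ℕ) (u v : Bool) (c : ℕ → ℚ) :
    stepOp s v (stepOp s u (stepOp s u c)) = stepOp s v (stepOp s v (stepOp s u c)) := by
  obtain rfl | rfl : v = u ∨ v = !u := by cases u <;> cases v <;> simp
  · rfl
  · set e := stepOp s u c with he
    -- Over two consecutive blocks the operators for `u` and `!u` add the same amounts in a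
    -- different order, so their partial sums agree at every other place and differ there by a
    -- single partial sum of `c`.
    have key : ∀ b, (∑ a ∈ Finset.range b, stepOp s u e a) =
        (∑ a ∈ Finset.range b, stepOp s (!u) e a) +
          if u = true ↔ ¬ Even (s + b) then 0 else ∑ a ∈ Finset.range b, c a := by
      intro b
      induction b with
      | zero => simp
      | succ b ih =>
        rw [Finset.sum_range_succ, Finset.sum_range_succ, ih]
        by_cases h : u = true ↔ ¬ Even (s + b)
        · rw [stepOp_of_match h, stepOp_of_not_match (mt match_not.1 (not_not.2 h)), if_pos h,
            if_neg (mt match_succ.1 (not_not.2 h)), he, stepOp_of_match h, Finset.sum_range_succ]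
          ring
        · rw [stepOp_of_not_match h, stepOp_of_match (match_not.2 h), if_neg h,
            if_pos (match_succ.2 h), he, stepOp_of_not_match h]
          ring
    funext b
    by_cases h : u = true ↔ ¬ Even (s + b)
    · have h' := mt match_not.1 (not_not.2 h)
      rw [stepOp_of_not_match h', stepOp_of_not_match h', key, if_pos h, add_zero]
    · have h' := match_not.2 h
      rw [stepOp_of_match h', stepOp_of_match h', key, if_neg h, stepOp_of_not_match h,
        stepOp_of_match h', he, stepOp_of_not_match h]
      ring

theorem stepOp_iterate (s : ℕ) (u v : Bool) (a : ℕ) (c : ℕ → ℚ) :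
    stepOp s v ((stepOp s u)^[a] (stepOp s u c)) =
      (stepOp s v)^[a] (stepOp s v (stepOp s u c)) := by
  induction a generalizing c with
  | zero => rfl
  | succ a ih =>
    rw [Function.iterate_succ_apply, ih, stepOp_stepOp_stepOp, Function.iterate_succ_apply]

/-- The direction of the `r`-th run, when that of the first one is `d`. -/
def runDir (d : Bool) (r : ℕ) : Bool := if Odd r then d else !d

theorem runDir_succ (d : Bool) (r : ℕ) : runDir d (r + 1) = !runDir d r := by
  unfold runDir
  by_cases h : Odd r
  · simp [h, Nat.odd_add_one]
  · simp [h, Nat.odd_add_one]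

/-- The transfer vector of a word with `r` steps and `r` runs. -/
def altVector (s : ℕ) (d : Bool) : ℕ → ℕ → ℚ
  | 0 => fun _ => 1
  | r + 1 => stepOp s (runDir d (r + 1)) (altVector s d r)

/-- The transfer vector of a word with `m` steps and `r` runs. -/
def runVector (s : ℕ) (d : Bool) (m r : ℕ) : ℕ → ℚ :=
  (stepOp s (runDir d r))^[m - r] (altVector s d r)

/-- The number of runs of the first `j` steps. -/
def runCount (D : Finset ℕ) (j : ℕ) : ℕ :=
  1 + (Finset.card {i ∈ Finset.Ico 2 (j + 1) | ¬ (i - 1 ∈ D ↔ i ∈ D)})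

theorem runCount_succ (D : Finset ℕ) {j : ℕ} (hj : 1 ≤ j) : runCount D (j + 1) =
    runCount D j + if j ∈ D ↔ j + 1 ∈ D then 0 else 1 := by
  unfold runCount
  rw [show Finset.Ico 2 (j + 1 + 1) = insert (j + 1) (Finset.Ico 2 (j + 1)) from
    (Finset.insert_Ico_right_eq_Ico_add_one (by omega)).symm, Finset.filter_insert, Nat.add_sub_cancel]
  by_cases h : j ∈ D ↔ j + 1 ∈ D
  · rw [if_neg (not_not.2 h), if_pos h]
    omega
  · rw [if_pos h, if_neg h, Finset.card_insert_of_notMem (by simp)]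
    omega

theorem runCount_le (D : Finset ℕ) {j : ℕ} (hj : 1 ≤ j) : runCount D j ≤ j := by
  have h := Finset.card_filter_le (Finset.Ico 2 (j + 1)) fun i => ¬ (i - 1 ∈ D ↔ i ∈ D)
  rw [Nat.card_Ico] at h
  unfold runCount
  omega

theorem one_le_runCount (D : Finset ℕ) (j : ℕ) : 1 ≤ runCount D j := Nat.le_add_right _ _

/-- In the normal form all runs but the last have a single step. A step in the same direction
lengthens the last run; a turn carries the surplus over into the new run. -/
theorem lastBlock_eq_runVector (s : ℕ) (D : Finset ℕ) {j : ℕ} (hj : 1 ≤ j) :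
    lastBlock s D j = runVector s (decide (1 ∈ D)) j (runCount D j) ∧
      decide (j ∈ D) = runDir (decide (1 ∈ D)) (runCount D j) := by
  induction j, hj using Nat.le_induction with
  | base =>
    have : runCount D 1 = 1 := by simp [runCount]
    rw [this]
    exact ⟨rfl, rfl⟩
  | succ j hj ih =>
    obtain ⟨ih1, ih2⟩ := ih
    have hle := runCount_le D hj
    rw [lastBlock, ih1, runCount_succ D hj]
    by_cases h : j ∈ D ↔ j + 1 ∈ D
    · rw [if_pos h, add_zero]
      have hd : decide (j + 1 ∈ D) = runDir (decide (1 ∈ D)) (runCount D j) := by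
        rw [← ih2, decide_eq_decide]
        exact h.symm
      refine ⟨?_, hd⟩
      rw [hd, runVector, runVector, ← Function.iterate_succ_apply' (stepOp s _),
        Nat.succ_sub hle]
    · rw [if_neg h]
      have hd : decide (j + 1 ∈ D) = runDir (decide (1 ∈ D)) (runCount D j + 1) := by
        rw [runDir_succ, ← ih2]
        by_cases h1 : j ∈ D <;> by_cases h2 : j + 1 ∈ D <;> simp_all
      refine ⟨?_, hd⟩
      rw [hd, runVector, runVector, Nat.add_sub_add_right, altVector]
      -- The run count is at least one, which exposes the first step of the old run:
      -- `stepOp_iterate` moves only the repetitions after it.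
      obtain ⟨r, hr⟩ := Nat.exists_eq_add_of_le' (one_le_runCount D j)
      rw [hr, altVector, stepOp_iterate]

/-- A nonnegative vector with leading index `b`. -/
def IsLeading (c : ℕ → ℚ) (b : ℕ) : Prop := (∀ a, 0 ≤ c a) ∧ (∀ a < b, c a = 0) ∧ 0 < c b

theorem stepOp_nonneg {c : ℕ → ℚ} (h : ∀ a, 0 ≤ c a) (s : ℕ) (u : Bool) (a : ℕ) :
    0 ≤ stepOp s u c a := by
  refine add_nonneg (Finset.sum_nonneg fun i _ => h i) ?_
  split_ifs
  · exact h a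
  · exact le_rfl

theorem IsLeading.stepOp_match {c : ℕ → ℚ} {b s : ℕ} {u : Bool} (h : IsLeading c b)
    (hu : u = true ↔ ¬ Even (s + b)) : IsLeading (stepOp s u c) b := by
  refine ⟨stepOp_nonneg h.1 s u, fun a ha => ?_, ?_⟩
  · rw [stepOp, Finset.sum_eq_zero fun i hi => h.2.1 i (by rw [Finset.mem_range] at hi; omega),
      h.2.1 a ha, ite_self, add_zero]
  · rw [stepOp_of_match hu]
    exact add_pos_of_nonneg_of_pos (Finset.sum_nonneg fun i _ => h.1 i) h.2.2

theorem IsLeading.stepOp_not_match {c : ℕ → ℚ} {b s : ℕ} {u : Bool} (h : IsLeading c b)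
    (hu : ¬ (u = true ↔ ¬ Even (s + b))) : IsLeading (stepOp s u c) (b + 1) := by
  refine ⟨stepOp_nonneg h.1 s u, fun a ha => ?_, ?_⟩
  · have hs : ∑ i ∈ Finset.range a, c i = 0 :=
      Finset.sum_eq_zero fun i hi => h.2.1 i (by rw [Finset.mem_range] at hi; omega)
    rcases Nat.lt_succ_iff_lt_or_eq.1 ha with hab | rfl
    · rw [stepOp, hs, h.2.1 a hab, ite_self, add_zero]
    · rw [stepOp_of_not_match hu, hs]
  · rw [stepOp_of_match (match_succ.2 hu), Finset.sum_range_succ]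
    have h1 := Finset.sum_nonneg fun i (_ : i ∈ Finset.range b) => h.1 i
    have h2 := h.1 (b + 1)
    have h3 := h.2.2
    linarith

/-- The leading index is the first block in which the word can end: each turn forces a new block,
and a first step against the direction of the first block costs one more. -/
theorem isLeading_altVector (s : ℕ) (d : Bool) (r : ℕ) :
    IsLeading (altVector s d (r + 1)) (r + if d = true ↔ ¬ Even s then 0 else 1) ∧
      (runDir d (r + 1) = true ↔
        ¬ Even (s + (r + if d = true ↔ ¬ Even s then 0 else 1))) := by
  induction r with
  | zero =>
    have h0 : IsLeading (altVector s d 0) 0 := ⟨fun _ => zero_le_one, by simp, zero_lt_one⟩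
    have hd : runDir d (0 + 1) = d := by simp [runDir]
    rw [altVector, hd]
    by_cases h : d = true ↔ ¬ Even s
    · rw [if_pos h]
      exact ⟨h0.stepOp_match h, h⟩
    · rw [if_neg h]
      exact ⟨h0.stepOp_not_match h, match_succ.2 h⟩
  | succ r ih =>
    obtain ⟨ih1, ih2⟩ := ih
    rw [altVector, runDir_succ d (r + 1)]
    have h1 := mt match_not.1 (not_not.2 ih2)
    rw [add_right_comm]
    exact ⟨ih1.stepOp_not_match h1, match_succ.2 h1⟩

theorem isLeading_runVector (s : ℕ) (d : Bool) (m r : ℕ) :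
    IsLeading (runVector s d m (r + 1)) (r + if d = true ↔ ¬ Even s then 0 else 1) := by
  obtain ⟨h1, h2⟩ := isLeading_altVector s d r
  unfold runVector
  induction m - (r + 1) with
  | zero => exact h1
  | succ a ih =>
    rw [Function.iterate_succ_apply']
    exact ih.stepOp_match h2

/-! ### The run space -/

/-- `Wᵣ⁻` or `Wᵣ⁺`, according to the direction of the first run. -/
noncomputable def runSum (n : ℕ) (d : Bool) (r : ℕ) : GroupAlg n :=
  if d = true then Wminus n r else Wplus n r

theorem coeff_runSum (n : ℕ) (d : Bool) (r : ℕ) (σ : Equiv.Perm (Fin n)) :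
    (runSum n d r).coeff σ = if run σ = r ∧ decide (1 ∈ descents σ) = d then 1 else 0 := by
  classical
  cases d with
  | true =>
    rw [runSum, if_pos rfl, Wminus, MonoidAlgebra.coeff_sum, Finset.sum_apply']
    simp only [MonoidAlgebra.coeff_single, Finsupp.single_apply, Finset.sum_ite_eq']
    simp
  | false =>
    rw [runSum, if_neg (by simp), Wplus, MonoidAlgebra.coeff_sum, Finset.sum_apply']
    simp only [MonoidAlgebra.coeff_single, Finsupp.single_apply, Finset.sum_ite_eq']
    simp

theorem run_eq_runCount {m : ℕ} (σ : Equiv.Perm (Fin (m + 1))) : run σ = runCount (descents σ) m := rfl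

theorem blockSum_eq_sum_runSum {m : ℕ} (hm : 1 ≤ m) (s k : ℕ) : blockSum (m + 1) s k =
    ∑ d : Bool, ∑ r ∈ Finset.Icc 1 m,
      (∑ b ∈ Finset.range k, runVector s d m r b) • runSum (m + 1) d r := by
  refine MonoidAlgebra.coeff_injective (Finsupp.ext fun σ => ?_)
  rw [coeff_blockSum, (lastBlock_eq_runVector s _ hm).1, MonoidAlgebra.coeff_sum,
    Finset.sum_apply', Finset.sum_eq_single (decide (1 ∈ descents σ)), MonoidAlgebra.coeff_sum,
    Finset.sum_apply', Finset.sum_eq_single (s := Finset.Icc 1 m) (runCount (descents σ) m)]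
  · rw [MonoidAlgebra.coeff_smul_apply, coeff_runSum, if_pos ⟨rfl, rfl⟩, smul_eq_mul, mul_one]
  · intro r _ hr
    rw [MonoidAlgebra.coeff_smul_apply, coeff_runSum, if_neg fun h => hr h.1.symm, smul_zero]
  · intro h
    exact absurd (Finset.mem_Icc.2 ⟨one_le_runCount _ _, runCount_le _ hm⟩) h
  · intro d _ hd
    rw [MonoidAlgebra.coeff_sum, Finset.sum_apply']
    refine Finset.sum_eq_zero fun r _ => ?_
    rw [MonoidAlgebra.coeff_smul_apply, coeff_runSum, if_neg fun h => hd h.2.symm, smul_zero]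
  · intro h
    exact absurd (Finset.mem_univ _) h

theorem runSpace_eq_span_runSum (m : ℕ) : runSpace (m + 1) = Submodule.span ℚ
    (Set.range fun p : Bool × Fin m => runSum (m + 1) p.1 (p.2 + 1)) := by
  unfold runSpace
  congr 1
  ext x
  constructor
  · rintro ⟨k, h1, h2, rfl | rfl⟩
    · exact ⟨(false, ⟨k - 1, by omega⟩), by simp [runSum, Nat.sub_add_cancel h1]⟩
    · exact ⟨(true, ⟨k - 1, by omega⟩), by simp [runSum, Nat.sub_add_cancel h1]⟩
  · rintro ⟨⟨d, r⟩, rfl⟩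
    refine ⟨r + 1, by omega, by omega, ?_⟩
    cases d
    · left; simp [runSum]
    · right; simp [runSum]

theorem runSum_mem_runSpace {m r : ℕ} (hr : r ∈ Finset.Icc 1 m) (d : Bool) :
    runSum (m + 1) d r ∈ runSpace (m + 1) := by
  rw [Finset.mem_Icc] at hr
  rw [runSpace_eq_span_runSum]
  refine Submodule.subset_span ⟨(d, ⟨r - 1, by omega⟩), ?_⟩
  simp only
  rw [Nat.sub_add_cancel hr.1]

theorem blockSum_mem_runSpace {m : ℕ} (hm : 1 ≤ m) (s k : ℕ) :
    blockSum (m + 1) s k ∈ runSpace (m + 1) := by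
  rw [blockSum_eq_sum_runSum hm]
  exact Submodule.sum_mem _ fun d _ => Submodule.sum_mem _ fun r hr =>
    Submodule.smul_mem _ _ (runSum_mem_runSpace hr d)

/-- Triangularity. If the first block has direction `d`, then `k` blocks accommodate at most `k`
runs starting with `d`, and fewer than `k` runs starting the other way. The coefficient of `runSum
(m + 1) d k` is positive, and the other terms that occur have fewer runs. -/
theorem runSum_mem_span_blockSum {m : ℕ} (hm : 1 ≤ m) {k : ℕ} (hk : k ∈ Finset.Icc 1 m) (d : Bool) :
    runSum (m + 1) d k ∈ Submodule.span ℚ {x | ∃ s k, x = blockSum (m + 1) s k} := by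
  induction k using Nat.strong_induction_on generalizing d with
  | _ k ih =>
    set W := Submodule.span ℚ {x | ∃ s k, x = blockSum (m + 1) s k}
    obtain ⟨s, hs⟩ : ∃ s : ℕ, d = true ↔ ¬ Even s := by
      cases d
      · exact ⟨0, by simp⟩
      · exact ⟨1, by simp⟩
    have h1 : blockSum (m + 1) s k ∈ W := Submodule.subset_span ⟨s, k, rfl⟩
    rw [blockSum_eq_sum_runSum hm, Fintype.sum_eq_add d (!d) (by cases d <;> simp)
      (fun x hx => by cases d <;> cases x <;> simp at hx), ← Finset.sum_erase_add _ _ hk,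
      add_right_comm] at h1
    have hk1 := (Finset.mem_Icc.1 hk).1
    have h2 : (∑ r ∈ (Finset.Icc 1 m).erase k,
        (∑ b ∈ Finset.range k, runVector s d m r b) • runSum (m + 1) d r) +
        ∑ r ∈ Finset.Icc 1 m,
          (∑ b ∈ Finset.range k, runVector s (!d) m r b) • runSum (m + 1) (!d) r ∈ W := by
      refine W.add_mem (W.sum_mem fun r hr => ?_) (W.sum_mem fun r hr => ?_)
      · rw [Finset.mem_erase] at hr
        have hr1 := (Finset.mem_Icc.1 hr.2).1
        rcases lt_or_gt_of_ne hr.1 with h | h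
        · exact W.smul_mem _ (ih r h hr.2 d)
        · obtain ⟨r, rfl⟩ := Nat.exists_eq_add_of_le' hr1
          have := (isLeading_runVector s d m r).2.1
          rw [if_pos hs] at this
          rw [Finset.sum_eq_zero fun b hb => this b (by rw [Finset.mem_range] at hb; omega), zero_smul]
          exact W.zero_mem
      · have hr1 := (Finset.mem_Icc.1 hr).1
        rcases lt_or_ge r k with h | h
        · exact W.smul_mem _ (ih r h hr (!d))
        · obtain ⟨r, rfl⟩ := Nat.exists_eq_add_of_le' hr1
          have := (isLeading_runVector s (!d) m r).2.1
          have hns : ¬ ((!d) = true ↔ ¬ Even s) := mt (match_not (b := 0)).1 (not_not.2 hs)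
          rw [if_neg hns] at this
          rw [Finset.sum_eq_zero fun b hb => this b (by rw [Finset.mem_range] at hb; omega), zero_smul]
          exact W.zero_mem
    have h3 := (W.add_mem_iff_right h2).1 h1
    refine (W.smul_mem_iff ?_).1 h3
    obtain ⟨k, rfl⟩ := Nat.exists_eq_add_of_le' hk1
    obtain ⟨h4, -, h5⟩ := isLeading_runVector s d m k
    rw [if_pos hs, add_zero] at h5
    rw [Finset.sum_range_succ]
    have h6 := Finset.sum_nonneg fun b (_ : b ∈ Finset.range k) => h4 b
    exact (by linarith : (0 : ℚ) < _).ne'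

theorem runSpace_eq_span_blockSum {m : ℕ} (hm : 1 ≤ m) :
    runSpace (m + 1) = Submodule.span ℚ {x | ∃ s k, x = blockSum (m + 1) s k} := by
  refine le_antisymm ?_ (Submodule.span_le.2 ?_)
  · rw [runSpace_eq_span_runSum, Submodule.span_le]
    rintro _ ⟨⟨d, r⟩, rfl⟩
    exact runSum_mem_span_blockSum hm (Finset.mem_Icc.2 ⟨by omega, r.isLt⟩) d
  · rintro _ ⟨s, k, rfl⟩
    exact blockSum_mem_runSpace hm s k

/-! ### The dimension of the run space -/

theorem exists_descents (m : ℕ) (e : ℕ → Bool) : ∃ σ : Equiv.Perm (Fin (m + 1)),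
    ∀ i, 1 ≤ i → i ≤ m → (i ∈ descents σ ↔ e i = true) := by
  -- As `|f i| = i` grows, the comparison of `f i` with its predecessor is decided by the sign of `f
  -- i`. The permutation that ranks these values therefore has the prescribed descents.
  set f : Fin (m + 1) → ℤ := fun i => if e i = true then -(i : ℤ) else i with hf
  have hinj : Function.Injective f := by
    intro i j h
    simp only [hf] at h
    ext
    split_ifs at h <;> omega
  have hmono : StrictMono (f ∘ Tuple.sort f) :=
    (Tuple.monotone_sort f).strictMono_of_injective (hinj.comp (Equiv.injective _))
  refine ⟨(Tuple.sort f).symm, fun i hi hm => ?_⟩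
  obtain ⟨i, rfl⟩ := Nat.exists_eq_add_of_le' hi
  have := mem_descents_iff (Tuple.sort f).symm ⟨i, hm⟩
  rw [← hmono.lt_iff_lt] at this
  simp only [Function.comp_apply, Equiv.apply_symm_apply] at this
  rw [this]
  simp only [hf, Fin.succ_mk, Fin.castSucc_mk]
  split_ifs <;> simp_all <;> omega

theorem exists_run_eq {m r : ℕ} (hr1 : 1 ≤ r) (hrm : r ≤ m) (d : Bool) :
    ∃ σ : Equiv.Perm (Fin (m + 1)), run σ = r ∧ decide (1 ∈ descents σ) = d := by
  -- Alternate for the first `r` steps, then keep the direction.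
  obtain ⟨σ, hσ⟩ := exists_descents m fun i => runDir d (min i r)
  refine ⟨σ, ?_, ?_⟩
  · rw [run_eq_runCount]
    have : ∀ j, 1 ≤ j → j ≤ m → runCount (descents σ) j = min j r := by
      intro j hj
      induction j, hj using Nat.le_induction with
      | base => intro _; rw [Nat.min_eq_left hr1]; simp [runCount]
      | succ j hj ih =>
        intro hjm
        rw [runCount_succ _ hj, ih (by omega)]
        simp only [hσ j hj (by omega), hσ (j + 1) (by omega) hjm]
        rcases lt_or_ge j r with h | h
        · rw [Nat.min_eq_left h.le, Nat.min_eq_left (Nat.succ_le_of_lt h), runDir_succ, if_neg (by simp)]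
        · rw [Nat.min_eq_right h, Nat.min_eq_right (by omega), if_pos Iff.rfl, add_zero]
    rw [this m (by omega) le_rfl, Nat.min_eq_right hrm]
  · have h := hσ 1 le_rfl (by omega)
    rw [Nat.min_eq_left hr1, show runDir d 1 = d by simp [runDir]] at h
    rw [Bool.eq_iff_iff, decide_eq_true_iff, h]

theorem finrank_runSpace (m : ℕ) : Module.finrank ℚ (runSpace (m + 1)) = 2 * m := by
  have hli : LinearIndependent ℚ fun p : Bool × Fin m => runSum (m + 1) p.1 (p.2 + 1) := by
    rw [Fintype.linearIndependent_iff]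
    rintro g hg ⟨d, r⟩
    obtain ⟨σ, h1, h2⟩ := exists_run_eq (m := m) (r := r + 1) (by omega) (by omega) d
    have := congrArg (fun x : GroupAlg (m + 1) => x.coeff σ) hg
    simp only [MonoidAlgebra.coeff_sum, Finset.sum_apply', MonoidAlgebra.coeff_smul_apply,
      coeff_runSum, h1, h2, smul_eq_mul, MonoidAlgebra.coeff_zero, Finsupp.zero_apply] at this
    rw [Finset.sum_eq_single (d, r), if_pos ⟨rfl, rfl⟩, mul_one] at this
    · exact this
    · rintro ⟨d', r'⟩ _ h
      rw [if_neg, mul_zero]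
      rintro ⟨h3, h4⟩
      exact h (Prod.ext h4.symm (Fin.ext (by simp only at h3 ⊢; omega)))
    · intro h
      exact absurd (Finset.mem_univ _) h
  rw [runSpace_eq_span_runSum, finrank_span_eq_card hli]
  simp

/-! ### The vanishing coefficients -/

theorem altLetter_zero : altLetter 0 = V1plus := if_pos Even.zero

theorem altLetter_one : altLetter 1 = V1minus := if_neg (by decide)

theorem altLetter_two : altLetter 2 = V1plus := if_pos even_two

theorem altCoeff_zero_zero (k : ℕ) : altCoeff 0 0 k = Iplus k := by
  rw [altCoeff, if_pos Even.zero, zero_add, altLetter_zero, altLetter_one]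
  rfl

theorem altCoeff_zero_one (k : ℕ) : altCoeff 0 1 k = Iminus k := by
  rw [altCoeff, if_pos Even.zero, one_add_one_eq_two, altLetter_two, altLetter_one]
  rfl

theorem altCoeff_one_zero (k : ℕ) : altCoeff 1 0 k = Jplus k := by
  rw [altCoeff, if_neg (by decide), zero_add, altLetter_zero, altLetter_one]
  rfl

theorem altCoeff_one_one (k : ℕ) : altCoeff 1 1 k = Jminus k := by
  rw [altCoeff, if_neg (by decide), one_add_one_eq_two, altLetter_two, altLetter_one]
  rfl

theorem groupCoeff_eq_zero_of_not_modEq {n k : ℕ} (x s : ℕ) (hk : ¬ k ≡ n [MOD 2]) :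
    groupCoeff n x s k = 0 := by
  rw [groupCoeff, degreePart, coeff_altCoeff_eq_zero x s hk, map_zero]

theorem groupCoeff_even_zero {n : ℕ} (hn : 0 < n) (s : ℕ) : groupCoeff n 0 s 0 = 0 := by
  rw [groupCoeff, degreePart, altCoeff, if_pos Even.zero, evenCoeff, dividedLog_zero,
    PowerSeries.coeff_one, if_neg hn.ne', map_zero]

theorem coeff_evenCoeff_altLetter (s n : ℕ) :
    PowerSeries.coeff n (evenCoeff (altLetter (s + 1)) (altLetter s) n) =
      PowerSeries.coeff n (evenCoeff V1plus V1minus n) := by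
  unfold altLetter
  simp only [Nat.even_add_one]
  by_cases h : Even s
  · rw [if_pos h, if_neg (not_not.2 h),
      coeff_evenCoeff_self_comm constantCoeff_V1minus constantCoeff_V1plus]
  · rw [if_neg h, if_pos h]

theorem groupCoeff_self (n x s : ℕ) : groupCoeff n x s n = groupCoeff n 0 0 n := by
  have key : ∀ x s, PowerSeries.coeff n (altCoeff x s n) =
      PowerSeries.coeff n (evenCoeff V1plus V1minus n) := by
    intro x s
    unfold altCoeff
    split_ifs
    · rw [coeff_evenCoeff_self_comm (constantCoeff_altLetter _) (constantCoeff_altLetter _),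
        coeff_evenCoeff_altLetter]
    · rw [coeff_oddCoeff_self (constantCoeff_altLetter _), coeff_evenCoeff_altLetter]
  rw [groupCoeff, groupCoeff, degreePart, degreePart, key, key]

/-- This relation is what shortens the second family of idempotents to `l ≤ n - 4`. -/
theorem groupCoeff_odd_add_two (n : ℕ) : groupCoeff (n + 2) 1 0 n + groupCoeff (n + 2) 1 1 n =
    groupCoeff (n + 2) 0 0 n + groupCoeff (n + 2) 0 1 n := by
  have h := coeff_oddCoeff_add_two constantCoeff_V1plus constantCoeff_V1minus
    negX_V1plus_mul_V1minus negX_V1minus_mul_V1plus n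
  have h' := congrArg (toGroupAlg (n + 2)) h
  rw [map_add, map_add] at h'
  simp only [groupCoeff, altCoeff_zero_zero, altCoeff_zero_one, altCoeff_one_zero, altCoeff_one_one]
  exact h'

/-! ### The idempotents -/

/-- The three families of idempotents, for all labels. -/
noncomputable def runElement (n : ℕ) : Fin 3 → ℕ → GroupAlg n
  | 0, k => (1 / 2 : ℚ) • (groupCoeff n 0 0 k + groupCoeff n 0 1 k)
  | 1, k => (1 / 2 : ℚ) •
      (groupCoeff n 1 0 k + groupCoeff n 1 1 k - groupCoeff n 0 0 k - groupCoeff n 0 1 k)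
  | 2, k => (1 / 2 : ℚ) • (groupCoeff n 1 0 k - groupCoeff n 1 1 k)

/-- The family and the label of an index. -/
def indexLabel (n : ℕ) : Index n → Fin 3 × ℕ
  | .inl k => (0, k)
  | .inr (.inl l) => (1, l)
  | .inr (.inr m) => (2, m)

theorem indexLabel_injective (n : ℕ) : Function.Injective (indexLabel n) := by
  rintro (i | i | i) (j | j | j) h <;>
  first
  | exact absurd (Prod.mk.inj h).1 (by decide)
  | obtain rfl := Subtype.ext (Prod.mk.inj h).2
    rfl

theorem indexLabel_lt (n : ℕ) (i : Index n) : (indexLabel n i).2 < n + 1 := by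
  rcases i with ⟨i, hi⟩ | ⟨i, hi⟩ | ⟨i, hi⟩ <;>
  · simp only [parityRange, Finset.mem_filter, Finset.mem_range] at hi
    exact hi.1

theorem runIdempotent_eq (n : ℕ) (i : Index n) :
    runIdempotent n i = runElement n (indexLabel n i).1 (indexLabel n i).2 := by
  rcases i with i | i | i <;>
  simp only [runIdempotent, indexLabel, runElement, groupCoeff, degreePart, altCoeff_zero_zero,
    altCoeff_zero_one, altCoeff_one_zero, altCoeff_one_one, PowerSeries.coeff_smul, map_smul, map_add,
    map_sub]

theorem groupCoeff_mul_self {n : ℕ} (hn : 0 < n) (x y s t : ℕ) {k : ℕ} (hk : k < n + 1) :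
    groupCoeff n x s k * groupCoeff n y t k = groupCoeff n (x * y) (s + t * x) k := by
  rw [groupCoeff_mul hn x y s t hk hk, if_pos rfl]

theorem groupCoeff_mul_of_ne {n : ℕ} (hn : 0 < n) (x y s t : ℕ) {k l : ℕ} (hk : k < n + 1) (hl : l < n + 1)
    (h : k ≠ l) : groupCoeff n x s k * groupCoeff n y t l = 0 := by
  rw [groupCoeff_mul hn x y s t hk hl, if_neg h]

theorem groupCoeff_two (n x k : ℕ) : groupCoeff n x 2 k = groupCoeff n x 0 k :=
  groupCoeff_congr ⟨x, rfl⟩ (by decide) k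

theorem runElement_mul {n : ℕ} (hn : 0 < n) (c d : Fin 3) {k l : ℕ} (hk : k < n + 1) (hl : l < n + 1) :
    runElement n c k * runElement n d l = if (c, k) = (d, l) then runElement n c k else 0 := by
  by_cases h : k = l
  · subst h
    fin_cases c <;> fin_cases d <;>
    simp [runElement, mul_add, add_mul, mul_sub, sub_mul, groupCoeff_mul_self hn, hk,
      groupCoeff_two] <;> module
  · rw [if_neg (by simp [h])]
    fin_cases c <;> fin_cases d <;>
    simp [runElement, mul_add, add_mul, mul_sub, sub_mul, groupCoeff_mul_of_ne hn, hk, hl, h]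

/-- The scalars are the three characters of the monoid of self-maps of two points: the trivial one,
the indicator `x'` of the permutations, and the sign `x' * (1 - 2 * s')` on permutations extended by
zero. -/
theorem runElement_mul_groupCoeff_mul {n : ℕ} (hn : 0 < n) (c : Fin 3) (x s : ℕ) {k l : ℕ} (hk : k < n + 1)
    (hl : l < n + 1) : ∃ a : ℚ,
      runElement n c k * groupCoeff n x s l * runElement n c k = a • runElement n c k := by
  obtain ⟨x', hx', hx⟩ : ∃ x' < 2, Even (x + x') :=
    ⟨x % 2, Nat.mod_lt _ two_pos, by rw [Nat.even_iff]; omega⟩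
  obtain ⟨s', hs', hs⟩ : ∃ s' < 2, Even (s + s') :=
    ⟨s % 2, Nat.mod_lt _ two_pos, by rw [Nat.even_iff]; omega⟩
  rw [groupCoeff_congr hx hs]
  by_cases h : k = l
  · subst h
    fin_cases c
    · refine ⟨1, ?_⟩
      interval_cases x' <;> interval_cases s' <;>
      simp [runElement, mul_add, add_mul, groupCoeff_mul_self hn, hk] <;> module
    · refine ⟨x', ?_⟩
      interval_cases x' <;> interval_cases s' <;>
      simp [runElement, mul_add, add_mul, mul_sub, sub_mul, groupCoeff_mul_self hn, hk,
        groupCoeff_two] <;> module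
    · refine ⟨x' * (1 - 2 * s'), ?_⟩
      interval_cases x' <;> interval_cases s' <;>
      simp [runElement, mul_sub, sub_mul, groupCoeff_mul_self hn, hk, groupCoeff_two] <;> module
  · refine ⟨0, ?_⟩
    fin_cases c <;>
    simp [runElement, mul_add, add_mul, mul_sub, sub_mul, groupCoeff_mul_of_ne hn, hk, hl, h]

/-! ### The run algebra -/

theorem mem_parityRange {n a d k : ℕ} :
    k ∈ parityRange n a d ↔ k < n + 1 ∧ a ≤ k ∧ k + d ≤ n ∧ k ≡ n [MOD 2] := by
  rw [parityRange, Finset.mem_filter, Finset.mem_range]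

theorem runElement_zero_eq_zero {n k : ℕ} (hn : 0 < n) (hk : k < n + 1) (h : k ∉ parityRange n 1 0) :
    runElement n 0 k = 0 := by
  rw [mem_parityRange] at h
  by_cases hm : k ≡ n [MOD 2]
  · obtain rfl : k = 0 := by
      by_contra h0
      exact h ⟨hk, by omega, by omega, hm⟩
    simp [runElement, groupCoeff_even_zero hn]
  · simp [runElement, groupCoeff_eq_zero_of_not_modEq _ _ hm]

theorem runElement_one_eq_zero {n k : ℕ} (hk : k < n + 1) (h : k ∉ parityRange n 0 4) :
    runElement n 1 k = 0 := by
  rw [mem_parityRange] at h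
  by_cases hm : k ≡ n [MOD 2]
  · have h4 : n < k + 4 := by
      by_contra h0
      exact h ⟨hk, by omega, by omega, hm⟩
    unfold Nat.ModEq at hm
    obtain rfl | rfl : n = k ∨ n = k + 2 := by omega
    · simp [runElement, groupCoeff_self n 1, groupCoeff_self n 0 1]
    · simp [runElement, groupCoeff_odd_add_two]
  · simp [runElement, groupCoeff_eq_zero_of_not_modEq _ _ hm]

theorem eq_of_not_mem_parityRange_two {n k a : ℕ} (hk : k < n + 1) (ha : a ≤ k)
    (h : k ∉ parityRange n a 2) (hm : k ≡ n [MOD 2]) : n = k := by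
  rw [mem_parityRange] at h
  have h2 : n < k + 2 := by
    by_contra h0
    exact h ⟨hk, by omega, by omega, hm⟩
  unfold Nat.ModEq at hm
  omega

theorem runElement_two_eq_zero {n k : ℕ} (hk : k < n + 1) (h : k ∉ parityRange n 0 2) :
    runElement n 2 k = 0 := by
  by_cases hm : k ≡ n [MOD 2]
  · obtain rfl := eq_of_not_mem_parityRange_two hk (Nat.zero_le k) h hm
    simp [runElement, groupCoeff_self n 1]
  · simp [runElement, groupCoeff_eq_zero_of_not_modEq _ _ hm]

/-- The elements `Iₖ⁺ - Iₖ⁻`, which span the radical. -/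
noncomputable def radicalElement (n k : ℕ) : GroupAlg n := groupCoeff n 0 0 k - groupCoeff n 0 1 k

theorem radicalElement_eq_zero {n k : ℕ} (hn : 0 < n) (hk : k < n + 1) (h : k ∉ parityRange n 1 2) :
    radicalElement n k = 0 := by
  unfold radicalElement
  by_cases hm : k ≡ n [MOD 2]
  · rcases Nat.eq_zero_or_pos k with rfl | hk0
    · simp [groupCoeff_even_zero hn]
    · obtain rfl := eq_of_not_mem_parityRange_two hk hk0 h hm
      rw [groupCoeff_self n 0 1, sub_self]
  · simp [groupCoeff_eq_zero_of_not_modEq _ _ hm]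

theorem card_parityRange {n a d : ℕ} (ha : a ≤ n) (hd : Even d) :
    (parityRange n a d).card = (n - a) / 2 + 1 - d / 2 := by
  rw [← Nat.card_Icc]
  symm
  obtain ⟨e, rfl⟩ := hd
  -- Count downwards from `n`: the labels are `n - 2i` with `d / 2 ≤ i ≤ (n - a) / 2`.
  refine Finset.card_nbij (fun i => n - 2 * i) ?_ ?_ ?_
  · intro i hi
    rw [Finset.mem_coe, Finset.mem_Icc] at hi
    dsimp only
    rw [Finset.mem_coe, mem_parityRange]
    refine ⟨by omega, by omega, by omega, ?_⟩
    unfold Nat.ModEq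
    omega
  · intro i hi j hj hij
    rw [Finset.mem_coe, Finset.mem_Icc] at hi hj
    simp only at hij
    omega
  · intro k hk
    rw [Finset.mem_coe, mem_parityRange] at hk
    obtain ⟨h1, h2, h3, h4⟩ := hk
    unfold Nat.ModEq at h4
    refine ⟨(n - k) / 2, ?_, ?_⟩
    · rw [Finset.mem_coe, Finset.mem_Icc]
      omega
    · simp only
      omega

theorem groupCoeff_mem_runSpace {n : ℕ} (hn : 2 ≤ n) (x s : ℕ) {k : ℕ} (hk : k < n + 1) :
    groupCoeff n x s k ∈ runSpace n := by
  refine mem_of_sum_pow_smul_mem (runSpace n) (infinite_setOf_odd_iff (Odd x)) (fun y hy => ?_) hk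
  have hy' : Even (x + y) := by
    rw [Set.mem_ofPred_eq] at hy
    rw [Nat.even_add, ← Nat.not_odd_iff_even, ← Nat.not_odd_iff_even, hy]
  simp only [groupCoeff_congr (n := n) hy' (⟨s, rfl⟩ : Even (s + s))]
  rw [← blockSum_eq_sum_groupCoeff (by omega)]
  obtain ⟨m, rfl⟩ := Nat.exists_eq_add_of_le' (show 1 ≤ n by omega)
  exact blockSum_mem_runSpace (by omega) s y

theorem runSpace_le_of_groupCoeff_mem {n : ℕ} (hn : 2 ≤ n) {W : Submodule ℚ (GroupAlg n)}
    (h : ∀ x s k, k < n + 1 → groupCoeff n x s k ∈ W) : runSpace n ≤ W := by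
  have hb : ∀ s k, blockSum n s k ∈ W := by
    intro s k
    rw [blockSum_eq_sum_groupCoeff (by omega)]
    exact W.sum_mem fun j hj => W.smul_mem _ (h _ _ _ (Finset.mem_range.1 hj))
  obtain ⟨m, rfl⟩ := Nat.exists_eq_add_of_le' (show 1 ≤ n by omega)
  rw [runSpace_eq_span_blockSum (by omega), Submodule.span_le]
  rintro _ ⟨s, k, rfl⟩
  exact hb s k

theorem runElement_mem_runSpace {n : ℕ} (hn : 2 ≤ n) (c : Fin 3) {k : ℕ} (hk : k < n + 1) :
    runElement n c k ∈ runSpace n := by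
  have h := fun x s => groupCoeff_mem_runSpace hn x s hk
  fin_cases c
  · exact Submodule.smul_mem _ _ (add_mem (h _ _) (h _ _))
  · exact Submodule.smul_mem _ _ (sub_mem (sub_mem (add_mem (h _ _) (h _ _)) (h _ _)) (h _ _))
  · exact Submodule.smul_mem _ _ (sub_mem (h _ _) (h _ _))

/-- The idempotents together with a basis of the radical. -/
noncomputable def runBasis (n : ℕ) : Index n ⊕ {k // k ∈ parityRange n 1 2} → GroupAlg n :=
  Sum.elim (runIdempotent n) fun k => radicalElement n k

/-- The three families and the radical elements recover the four coefficients: `I^±` is the first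
family plus or minus half the radical element, and `J^±` is the sum of the first two plus or minus
the third. Labels outside the ranges contribute zero. -/
theorem span_runBasis {n : ℕ} (hn : 2 ≤ n) :
    Submodule.span ℚ (Set.range (runBasis n)) = runSpace n := by
  have hn0 : 0 < n := by omega
  refine le_antisymm (Submodule.span_le.2 ?_) (runSpace_le_of_groupCoeff_mem hn fun x s k hk => ?_)
  · rintro _ ⟨i | ⟨k, hk⟩, rfl⟩
    · rw [runBasis, Sum.elim_inl, runIdempotent_eq]
      exact runElement_mem_runSpace hn _ (indexLabel_lt n i)
    · have hk' := (mem_parityRange.1 hk).1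
      exact sub_mem (groupCoeff_mem_runSpace hn _ _ hk') (groupCoeff_mem_runSpace hn _ _ hk')
  · set W := Submodule.span ℚ (Set.range (runBasis n))
    have h0 : runElement n 0 k ∈ W := by
      by_cases h : k ∈ parityRange n 1 0
      · exact Submodule.subset_span ⟨.inl (.inl ⟨k, h⟩), runIdempotent_eq n (.inl ⟨k, h⟩)⟩
      · rw [runElement_zero_eq_zero hn0 hk h]
        exact W.zero_mem
    have h1 : runElement n 1 k ∈ W := by
      by_cases h : k ∈ parityRange n 0 4
      · exact Submodule.subset_span ⟨.inl (.inr (.inl ⟨k, h⟩)), runIdempotent_eq n (.inr (.inl ⟨k, h⟩))⟩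
      · rw [runElement_one_eq_zero hk h]
        exact W.zero_mem
    have h2 : runElement n 2 k ∈ W := by
      by_cases h : k ∈ parityRange n 0 2
      · exact Submodule.subset_span ⟨.inl (.inr (.inr ⟨k, h⟩)), runIdempotent_eq n (.inr (.inr ⟨k, h⟩))⟩
      · rw [runElement_two_eq_zero hk h]
        exact W.zero_mem
    have h3 : radicalElement n k ∈ W := by
      by_cases h : k ∈ parityRange n 1 2
      · exact Submodule.subset_span ⟨.inr ⟨k, h⟩, rfl⟩
      · rw [radicalElement_eq_zero hn0 hk h]
        exact W.zero_mem
    obtain ⟨x', hx', hx⟩ : ∃ x' < 2, Even (x + x') :=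
      ⟨x % 2, Nat.mod_lt _ two_pos, by rw [Nat.even_iff]; omega⟩
    obtain ⟨s', hs', hs⟩ : ∃ s' < 2, Even (s + s') :=
      ⟨s % 2, Nat.mod_lt _ two_pos, by rw [Nat.even_iff]; omega⟩
    rw [groupCoeff_congr hx hs]
    interval_cases x' <;> interval_cases s'
    · rw [show groupCoeff n 0 0 k = runElement n 0 k + (1 / 2 : ℚ) • radicalElement n k by
        simp only [runElement, radicalElement]; module]
      exact add_mem h0 (W.smul_mem _ h3)
    · rw [show groupCoeff n 0 1 k = runElement n 0 k - (1 / 2 : ℚ) • radicalElement n k by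
        simp only [runElement, radicalElement]; module]
      exact sub_mem h0 (W.smul_mem _ h3)
    · rw [show groupCoeff n 1 0 k = runElement n 0 k + runElement n 1 k + runElement n 2 k by
        simp only [runElement]; module]
      exact add_mem (add_mem h0 h1) h2
    · rw [show groupCoeff n 1 1 k = runElement n 0 k + runElement n 1 k - runElement n 2 k by
        simp only [runElement]; module]
      exact sub_mem (add_mem h0 h1) h2

/-- A spanning family with as many members as the dimension `2(n - 1)` is independent. No
coefficient has to be shown nonzero directly. -/
theorem linearIndependent_runBasis {n : ℕ} (hn : 2 ≤ n) : LinearIndependent ℚ (runBasis n) := by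
  rw [linearIndependent_iff_card_eq_finrank_span, Set.finrank, span_runBasis hn]
  obtain ⟨m, rfl⟩ := Nat.exists_eq_add_of_le' (show 1 ≤ n by omega)
  rw [finrank_runSpace]
  simp only [Fintype.card_sum, Fintype.card_coe]
  rw [card_parityRange (by omega) Even.zero, card_parityRange (by omega) (by decide),
    card_parityRange (by omega) even_two, card_parityRange (by omega) even_two]
  omega

theorem runIdempotent_ne_zero {n : ℕ} (hn : 2 ≤ n) (i : Index n) : runIdempotent n i ≠ 0 :=
  (linearIndependent_runBasis hn).ne_zero (Sum.inl i)

/-- For each `k` the three families add up to `Jₖ⁺`, and the sum of these is the polynomial of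
`blockSum n 0 x` for odd `x` evaluated at `x = 1`: a single ascending block, which is the identity
permutation. -/
theorem sum_runIdempotent {n : ℕ} (hn : 2 ≤ n) : ∑ i, runIdempotent n i = 1 := by
  have hn0 : 0 < n := by omega
  have hsum : ∀ (c : Fin 3) (a d : ℕ),
      (∀ k, k < n + 1 → k ∉ parityRange n a d → runElement n c k = 0) →
      ∑ k : {k // k ∈ parityRange n a d}, runElement n c k =
        ∑ k ∈ Finset.range (n + 1), runElement n c k := by
    intro c a d h
    rw [Finset.sum_coe_sort (parityRange n a d) fun k => runElement n c k]
    refine Finset.sum_subset (Finset.filter_subset _ _) fun k hk hk' => ?_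
    exact h k (Finset.mem_range.1 hk) hk'
  simp only [runIdempotent_eq]
  rw [Fintype.sum_sum_type, Fintype.sum_sum_type]
  simp only [indexLabel]
  rw [hsum 0 1 0 fun k hk h => runElement_zero_eq_zero hn0 hk h,
    hsum 1 0 4 fun k hk h => runElement_one_eq_zero hk h,
    hsum 2 0 2 fun k hk h => runElement_two_eq_zero hk h, ← Finset.sum_add_distrib,
    ← Finset.sum_add_distrib, ← blockSum_one_block, blockSum_eq_sum_groupCoeff hn0]
  refine Finset.sum_congr rfl fun k _ => ?_
  simp only [runElement, Nat.cast_one, one_pow]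
  module

theorem one_mem_runSpace {n : ℕ} (hn : 2 ≤ n) : (1 : GroupAlg n) ∈ runSpace n := by
  obtain ⟨m, rfl⟩ := Nat.exists_eq_add_of_le' (show 1 ≤ n by omega)
  rw [← blockSum_one_block]
  exact blockSum_mem_runSpace (by omega) 0 1

theorem mul_mem_runSpace {n : ℕ} (hn : 2 ≤ n) {x y : GroupAlg n} (hx : x ∈ runSpace n)
    (hy : y ∈ runSpace n) : x * y ∈ runSpace n := by
  obtain ⟨m, rfl⟩ := Nat.exists_eq_add_of_le' (show 1 ≤ n by omega)
  have hm : 1 ≤ m := by omega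
  have h : runSpace (m + 1) * runSpace (m + 1) ≤ runSpace (m + 1) := by
    conv_lhs => rw [runSpace_eq_span_blockSum hm]
    rw [Submodule.span_mul_span, Submodule.span_le]
    rintro _ ⟨_, ⟨s, k, rfl⟩, _, ⟨t, l, rfl⟩, rfl⟩
    simp only [blockSum_mul]
    exact blockSum_mem_runSpace hm _ _
  exact h (Submodule.mul_mem_mul hx hy)

/-- The run algebra. -/
noncomputable def runAlgebra {n : ℕ} (hn : 2 ≤ n) : Subalgebra ℚ (GroupAlg n) :=
  (runSpace n).toSubalgebra (one_mem_runSpace hn) fun _ _ => mul_mem_runSpace hn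

theorem exists_runElement_mul_mul {n : ℕ} (hn : 2 ≤ n) (c : Fin 3) {k : ℕ} (hk : k < n + 1)
    {x : GroupAlg n} (hx : x ∈ runSpace n) :
    ∃ a : ℚ, runElement n c k * x * runElement n c k = a • runElement n c k := by
  have h : runSpace n ≤ (Submodule.span ℚ {runElement n c k}).comap
      ((LinearMap.mulRight ℚ (runElement n c k)).comp (LinearMap.mulLeft ℚ (runElement n c k))) := by
    refine runSpace_le_of_groupCoeff_mem hn fun x s l hl => ?_
    obtain ⟨a, ha⟩ := runElement_mul_groupCoeff_mul (by omega) c x s hk hl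
    exact Submodule.mem_span_singleton.2 ⟨a, ha.symm⟩
  obtain ⟨a, ha⟩ := Submodule.mem_span_singleton.1 (h hx)
  exact ⟨a, ha.symm⟩

/-- If `e = f + g` is an orthogonal decomposition, then `f = e f e` is a multiple `a • e`.
Idempotence forces `a` to be `0` or `1`. -/
theorem isPrimitiveIdempotent_of_forall_exists_smul {K R : Type*} [Field K] [Ring R] [Algebra K R]
    {e : R} (he : IsIdempotentElem e) (h0 : e ≠ 0) (h : ∀ x, ∃ a : K, e * x * e = a • e) :
    IsPrimitiveIdempotent e := by
  refine ⟨he, h0, fun f g hf hg hfg hgf hefg => ?_⟩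
  obtain ⟨a, ha⟩ := h f
  have hf' : f = a • e := by
    rw [← ha, hefg, add_mul, hgf, add_zero, hf.eq, mul_add, hfg, add_zero, hf.eq]
  have ha2 : (a * a - a) • e = 0 := by
    have := hf.eq
    rw [hf', smul_mul_smul_comm, he.eq] at this
    rw [sub_smul, this, sub_self]
  have ha3 : a * (a - 1) = 0 := by
    rw [mul_sub, mul_one]
    exact (smul_eq_zero.1 ha2).resolve_right h0
  rcases mul_eq_zero.1 ha3 with h1 | h1
  · left
    rw [hf', h1, zero_smul]
  · right
    rw [sub_eq_zero.1 h1, one_smul] at hf'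
    rw [← hf'] at hefg
    exact left_eq_add.1 hefg

end RunAlgebra

theorem mainTheorem5 (n : ℕ) (hn : 2 ≤ n) :
    ∃ A : Subalgebra ℚ (RunAlgebra.GroupAlg n),
      Subalgebra.toSubmodule A = RunAlgebra.runSpace n ∧
      ∃ e : RunAlgebra.Index n → A,
        (∀ i, (e i : RunAlgebra.GroupAlg n) = RunAlgebra.runIdempotent n i) ∧
        RunAlgebra.IsCompletePrimitiveOrthogonal e := by
  have hn0 : 0 < n := by omega
  have hmul : ∀ i j, RunAlgebra.runIdempotent n i * RunAlgebra.runIdempotent n j =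
      if i = j then RunAlgebra.runIdempotent n i else 0 := by
    intro i j
    rw [RunAlgebra.runIdempotent_eq, RunAlgebra.runIdempotent_eq, RunAlgebra.runElement_mul hn0 _ _
      (RunAlgebra.indexLabel_lt n i) (RunAlgebra.indexLabel_lt n j)]
    exact if_congr (RunAlgebra.indexLabel_injective n).eq_iff rfl rfl
  have hmem : ∀ i, RunAlgebra.runIdempotent n i ∈ RunAlgebra.runAlgebra hn := by
    intro i
    rw [RunAlgebra.runIdempotent_eq]
    exact RunAlgebra.runElement_mem_runSpace hn _ (RunAlgebra.indexLabel_lt n i)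
  have hidem : ∀ i, IsIdempotentElem (⟨_, hmem i⟩ : RunAlgebra.runAlgebra hn) := fun i =>
    Subtype.ext ((hmul i i).trans (if_pos rfl))
  refine ⟨RunAlgebra.runAlgebra hn, rfl, fun i => ⟨_, hmem i⟩, fun _ => rfl,
    ⟨⟨⟨hidem, fun i j hij => Subtype.ext ((hmul i j).trans (if_neg hij))⟩, ?_⟩, fun i => ?_⟩⟩
  · refine Subtype.ext ?_
    rw [AddSubmonoidClass.coe_finsetSum]
    exact RunAlgebra.sum_runIdempotent hn
  · refine RunAlgebra.isPrimitiveIdempotent_of_forall_exists_smul (K := ℚ) (hidem i)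
      (fun h => RunAlgebra.runIdempotent_ne_zero hn i (congrArg Subtype.val h)) fun x => ?_
    obtain ⟨a, ha⟩ := RunAlgebra.exists_runElement_mul_mul hn (RunAlgebra.indexLabel n i).1
      (RunAlgebra.indexLabel_lt n i) x.2
    rw [← RunAlgebra.runIdempotent_eq] at ha
    exact ⟨a, Subtype.ext ha⟩
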